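/- Let $g(u) = 2u\ln u + 2(1-u)\ln(1-u) + 1$ for $0<u<1$. For a probability law $G$ on $\mathbb{R}$ let $SG$ be the law of $UV + (1-U)V^* + g(U)$, where $U, V, V^*$ are independent, $U$ is uniform on $(0,1)$, and $V, V^*$ both have law $G$. There is exactly one probability law $F$ on $\mathbb{R}$ with mean zero and finite variance such that $SF = F$ (the limiting Quicksort distribution); let $\sigma^2$ be its variance. For probability laws $P, Q$ on $\mathbb{R}$ put $$d_{TV}(P,Q) = \sup_{B\subseteq\mathbb{R}\text{ Borel}} |P(B)-Q(B)|, \qquad d_{KS}(P,Q) = \sup_{x\in\mathbb{R}} |P((-\infty,x]) - Q((-\infty,x])|.$$ Theorem. Let $Z_0$ be a real random variable with $\mathbf{E}Z_0 = 0$ and $\mathbf{Var}\,Z_0 < \infty$, let $F_0$ be its law, let $F_n = S^nF_0$ for $n \ge 0$, and let $A = (\mathbf{Var}\,Z_0 + \sigma^2)^{1/2}$. Then $d_{KS}(F_n,F) \le d_{TV}(F_n,F)$ for every $n\ge0$, and $d_{TV}(F_n,F) = O(r^n)$ as $n\to\infty$ for every fixed $r > (2/3)^{1/2}$. Explicitly,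 for every $n \ge 1$, $$d_{KS}(F_n,F) \le d_{TV}(F_n,F) \le 135\,A\,n\,\left(\tfrac23\right)^{(n/2) - 3.7\sqrt n}.$$ -/

import Mathlib

open MeasureTheory ProbabilityTheory

/-- The function `g(u) = 2u ln u + 2(1-u) ln(1-u) + 1` on `[0, 1]` (with `0 ln 0 = 0`). -/
noncomputable def quicksortG (u : ℝ) : ℝ :=
  2 * u * Real.log u + 2 * (1 - u) * Real.log (1 - u) + 1

/-- The transformation `S` of laws on `ℝ`: `S G` is the law of `U V + (1 - U) V* + g(U)`, where
`U`, `V`, `V*` are independent, `U` is uniform on `(0, 1)`, and `V`, `V*` have law `G`. -/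
noncomputable def quicksortOp (G : Measure ℝ) : Measure ℝ :=
  ((volume.restrict (Set.Ioo (0 : ℝ) 1)).prod (G.prod G)).map
    fun p : ℝ × ℝ × ℝ => p.1 * p.2.1 + (1 - p.1) * p.2.2 + quicksortG p.1

theorem measurable_quicksortG : Measurable quicksortG := by
  unfold quicksortG
  fun_prop

instance isProbabilityMeasure_quicksortOp (G : Measure ℝ) [IsProbabilityMeasure G] :
    IsProbabilityMeasure (quicksortOp G) := by
  have hU : IsProbabilityMeasure (volume.restrict (Set.Ioo (0 : ℝ) 1)) := ⟨by simp⟩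
  have hg := measurable_quicksortG
  exact Measure.isProbabilityMeasure_map (by fun_prop)

/-- `F` is a limiting Quicksort law: a probability law on `ℝ` with finite variance and mean zero
that is a fixed point of the transformation `S`. -/
structure IsQuicksortLaw (F : Measure ℝ) : Prop where
  isProbabilityMeasure : IsProbabilityMeasure F
  memLp : MemLp id 2 F
  mean_zero : ∫ x, x ∂F = 0
  fixed : quicksortOp F = F

/-- Total variation distance `sup_B |P(B) - Q(B)|` of probability laws on `ℝ`, over Borel sets. -/
noncomputable def tvDist (P Q : Measure ℝ) : ℝ :=
  ⨆ B : {B : Set ℝ // MeasurableSet B}, |P.real B - Q.real B|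

/-- Kolmogorov–Smirnov distance `sup_x |P((-∞, x]) - Q((-∞, x])|` of probability laws on `ℝ`. -/
noncomputable def ksDist (P Q : Measure ℝ) : ℝ :=
  ⨆ x : ℝ, |P.real (Set.Iic x) - Q.real (Set.Iic x)|

/-- First-derivative van der Corput estimate for a phase with increasing derivative. -/
theorem norm_integral_exp_le_of_deriv {h h' h'' : ℝ → ℝ} {a b l t : ℝ} (hab : a ≤ b)
    (hl : 0 < l) (ht : t ≠ 0)
    (hh : ∀ x ∈ Set.Icc a b, HasDerivAt h (h' x) x)
    (hh' : ∀ x ∈ Set.Icc a b, HasDerivAt h' (h'' x) x)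
    (hc : ContinuousOn h'' (Set.Icc a b)) (h0 : ∀ x ∈ Set.Icc a b, 0 ≤ h'' x)
    (hla : l ≤ h' a) :
    ‖∫ x in a..b, Complex.exp (t * h x * Complex.I)‖ ≤ 2 / (|t| * l) := by
  have hu : Set.uIcc a b = Set.Icc a b := Set.uIcc_of_le hab
  have hmono : ∀ x ∈ Set.Icc a b, h' a ≤ h' x := by
    intro x hx
    have hm : MonotoneOn h' (Set.Icc a b) := by
      refine monotoneOn_of_deriv_nonneg (convex_Icc a b)
        (fun x hx => (hh' x hx).continuousAt.continuousWithinAt) ?_ ?_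
      · intro x hx
        exact (hh' x (interior_subset hx)).differentiableAt.differentiableWithinAt
      · intro x hx
        rw [(hh' x (interior_subset hx)).deriv]
        exact h0 x (interior_subset hx)
    exact hm (Set.left_mem_Icc.2 hab) hx hx.1
  have hpos : ∀ x ∈ Set.Icc a b, 0 < h' x := fun x hx => by linarith [hmono x hx]
  have hch : ContinuousOn h (Set.Icc a b) := fun x hx => (hh x hx).continuousAt.continuousWithinAt
  have hch' : ContinuousOn h' (Set.Icc a b) :=
    fun x hx => (hh' x hx).continuousAt.continuousWithinAt
  have htI : (t : ℂ) * Complex.I ≠ 0 := by simp [ht]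
  -- derivative of the reciprocal
  have hr : ∀ x ∈ Set.Icc a b, HasDerivAt (fun x => (h' x)⁻¹) (-h'' x / h' x ^ 2) x :=
    fun x hx => (hh' x hx).inv (hpos x hx).ne'
  have hrc : ContinuousOn (fun x => -h'' x / h' x ^ 2) (Set.Icc a b) :=
    hc.neg.div (hch'.pow 2) fun x hx => by have := hpos x hx; positivity
  have hv : ∀ x ∈ Set.uIcc a b, HasDerivAt (fun x => Complex.exp (t * h x * Complex.I))
      (Complex.exp (t * h x * Complex.I) * (t * h' x * Complex.I)) x := by
    intro x hx
    rw [hu] at hx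
    have := (((hh x hx).ofReal_comp.const_mul (t : ℂ)).mul_const Complex.I).cexp
    simpa using this
  have huu : ∀ x ∈ Set.uIcc a b, HasDerivAt (fun x => (((h' x)⁻¹ : ℝ) : ℂ) / (t * Complex.I))
      (((-h'' x / h' x ^ 2 : ℝ) : ℂ) / (t * Complex.I)) x := by
    intro x hx
    rw [hu] at hx
    exact (hr x hx).ofReal_comp.div_const _
  have hexpc : ContinuousOn (fun x => Complex.exp (t * h x * Complex.I)) (Set.Icc a b) := by
    fun_prop
  have hi1 : IntervalIntegrable (fun x => ((-h'' x / h' x ^ 2 : ℝ) : ℂ) / (t * Complex.I))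
      volume a b := by
    apply ContinuousOn.intervalIntegrable
    rw [hu]
    exact (Complex.continuous_ofReal.comp_continuousOn hrc).div_const _
  have hi2 : IntervalIntegrable (fun x => Complex.exp (t * h x * Complex.I) *
      (t * h' x * Complex.I)) volume a b := by
    apply ContinuousOn.intervalIntegrable
    rw [hu]
    fun_prop
  have key := intervalIntegral.integral_mul_deriv_eq_deriv_mul huu hv hi1 hi2
  have e1 : ∫ x in a..b, Complex.exp (t * h x * Complex.I) =
      ∫ x in a..b, (((h' x)⁻¹ : ℝ) : ℂ) / (t * Complex.I) *
        (Complex.exp (t * h x * Complex.I) * (t * h' x * Complex.I)) := by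
    apply intervalIntegral.integral_congr
    intro x hx
    rw [hu] at hx
    have h1 : ((h' x : ℝ) : ℂ) ≠ 0 := by exact_mod_cast (hpos x hx).ne'
    have h2 : (t : ℂ) ≠ 0 := by exact_mod_cast ht
    simp only [Complex.ofReal_inv]
    field_simp
  have hn : ∀ x : ℝ, ‖Complex.exp (t * h x * Complex.I)‖ = 1 := fun x => by
    rw [← Complex.ofReal_mul]; exact Complex.norm_exp_ofReal_mul_I _
  have ht' : 0 < |t| := abs_pos.2 ht
  have e2 : ‖∫ x in a..b, ((-h'' x / h' x ^ 2 : ℝ) : ℂ) / (t * Complex.I) *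
      Complex.exp (t * h x * Complex.I)‖ ≤ ((h' a)⁻¹ - (h' b)⁻¹) / |t| := by
    have e3 : ∫ x in a..b, (-h'' x / h' x ^ 2) = (h' b)⁻¹ - (h' a)⁻¹ := by
      apply intervalIntegral.integral_eq_sub_of_hasDerivAt (f := fun x => (h' x)⁻¹)
      · intro x hx
        rw [hu] at hx
        exact hr x hx
      · apply ContinuousOn.intervalIntegrable
        rwa [hu]
    have e4 : ((h' a)⁻¹ - (h' b)⁻¹) / |t| = ∫ x in a..b, -(-h'' x / h' x ^ 2) / |t| := by
      rw [intervalIntegral.integral_div, intervalIntegral.integral_neg, e3]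
      ring
    rw [e4]
    refine intervalIntegral.norm_integral_le_of_norm_le hab ?_ ?_
    · refine Filter.Eventually.of_forall fun x hx => ?_
      have hx' := Set.Ioc_subset_Icc_self hx
      rw [norm_mul, hn, mul_one, norm_div, norm_mul, Complex.norm_I, mul_one, Complex.norm_real,
        Complex.norm_real, Real.norm_eq_abs, Real.norm_eq_abs, neg_div, abs_neg, neg_neg,
        abs_of_nonneg (div_nonneg (h0 x hx') (sq_nonneg _))]
    · apply ContinuousOn.intervalIntegrable
      rw [hu]
      exact hrc.neg.div_const _
  rw [e1, key]
  have hb := Set.right_mem_Icc.2 hab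
  have ha := Set.left_mem_Icc.2 hab
  have e5 : ∀ x ∈ Set.Icc a b, ‖(((h' x)⁻¹ : ℝ) : ℂ) / (t * Complex.I) *
      Complex.exp (t * h x * Complex.I)‖ = (h' x)⁻¹ / |t| := by
    intro x hx
    rw [norm_mul, hn, mul_one, norm_div, norm_mul, Complex.norm_I, mul_one, Complex.norm_real,
        Complex.norm_real, Real.norm_eq_abs, Real.norm_eq_abs, abs_of_pos (inv_pos.2 (hpos x hx))]
  have e6 : (h' a)⁻¹ ≤ l⁻¹ := inv_anti₀ hl hla
  calc _ ≤ (h' b)⁻¹ / |t| + (h' a)⁻¹ / |t| + ((h' a)⁻¹ - (h' b)⁻¹) / |t| := by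
        refine (norm_sub_le _ _).trans (add_le_add ((norm_sub_le _ _).trans ?_) e2)
        rw [e5 a ha, e5 b hb]
    _ = 2 * (h' a)⁻¹ / |t| := by ring
    _ ≤ 2 * l⁻¹ / |t| := by gcongr
    _ = 2 / (|t| * l) := by field_simp

theorem quicksortG_eq (u : ℝ) : quicksortG u = 1 - 2 * Real.binEntropy u := by
  rw [quicksortG, Real.binEntropy, Real.log_inv, Real.log_inv]
  ring

theorem continuous_quicksortG : Continuous quicksortG := by
  simp_rw [funext quicksortG_eq]
  fun_prop

theorem quicksortG_one_sub (u : ℝ) : quicksortG (1 - u) = quicksortG u := by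
  simp [quicksortG_eq]

theorem hasDerivAt_quicksortG {u : ℝ} (hu : u ∈ Set.Ioo (0 : ℝ) 1) :
    HasDerivAt quicksortG (2 * Real.log u - 2 * Real.log (1 - u)) u := by
  simp_rw [funext quicksortG_eq]
  convert! ((Real.hasDerivAt_binEntropy hu.1.ne' hu.2.ne).const_mul 2).const_sub 1 using 1
  ring

theorem hasDerivAt_deriv_quicksortG {u : ℝ} (hu : u ∈ Set.Ioo (0 : ℝ) 1) :
    HasDerivAt (fun u => 2 * Real.log u - 2 * Real.log (1 - u)) (2 / u + 2 / (1 - u)) u := by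
  have h1 := (Real.hasDerivAt_log hu.1.ne').const_mul 2
  have h2 := (((hasDerivAt_id u).const_sub 1).log (sub_ne_zero.2 hu.2.ne')).const_mul 2
  convert! h1.sub h2 using 1
  simp only [id]
  ring

theorem eight_le_deriv2_quicksortG {u : ℝ} (hu : u ∈ Set.Ioo (0 : ℝ) 1) :
    8 ≤ 2 / u + 2 / (1 - u) := by
  have h1 := hu.1
  have h2 : 0 < 1 - u := sub_pos.2 hu.2
  rw [div_add_div _ _ h1.ne' h2.ne', le_div_iff₀ (by positivity)]
  nlinarith [sq_nonneg (2 * u - 1)]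

/-- The stationary point of the phase `u ↦ c u + g(u)`. -/
noncomputable def phaseCenter (c : ℝ) : ℝ := (1 + Real.exp (c / 2))⁻¹

theorem phaseCenter_mem (c : ℝ) : phaseCenter c ∈ Set.Ioo (0 : ℝ) 1 := by
  have := Real.exp_pos (c / 2)
  exact ⟨by unfold phaseCenter; positivity, inv_lt_one_of_one_lt₀ (by linarith)⟩

theorem phaseCenter_neg (c : ℝ) : phaseCenter (-c) = 1 - phaseCenter c := by
  have := Real.exp_pos (c / 2)
  rw [phaseCenter, phaseCenter, neg_div, Real.exp_neg]
  field_simp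
  ring

theorem deriv_phaseCenter (c : ℝ) :
    c + (2 * Real.log (phaseCenter c) - 2 * Real.log (1 - phaseCenter c)) = 0 := by
  have h := Real.exp_pos (c / 2)
  have e : 1 - phaseCenter c = Real.exp (c / 2) * phaseCenter c := by
    rw [phaseCenter]; field_simp; ring
  rw [e, Real.log_mul h.ne' (phaseCenter_mem c).1.ne', Real.log_exp]
  ring

theorem mul_le_deriv_phase {c d : ℝ} (hd : 0 < d) (h1 : phaseCenter c + d < 1) :
    8 * d ≤ c + (2 * Real.log (phaseCenter c + d) - 2 * Real.log (1 - (phaseCenter c + d))) := by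
  have h0 := phaseCenter_mem c
  obtain ⟨x, hx, hx'⟩ := exists_hasDerivAt_eq_slope
    (fun u => 2 * Real.log u - 2 * Real.log (1 - u)) (fun u => 2 / u + 2 / (1 - u))
    (show phaseCenter c < phaseCenter c + d by linarith)
    (fun x hx => (hasDerivAt_deriv_quicksortG
      ⟨h0.1.trans_le hx.1, hx.2.trans_lt h1⟩).continuousAt.continuousWithinAt)
    (fun x hx => hasDerivAt_deriv_quicksortG ⟨h0.1.trans hx.1, hx.2.trans h1⟩)
  have h8 := eight_le_deriv2_quicksortG (u := x) ⟨h0.1.trans hx.1, hx.2.trans h1⟩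
  rw [hx', add_sub_cancel_left, le_div_iff₀ hd] at h8
  linarith [deriv_phaseCenter c]

theorem norm_integral_exp_phase_right {c d t : ℝ} (hd : 0 < d) (ht : t ≠ 0)
    (h1 : phaseCenter c + d ≤ 1) :
    ‖∫ u in (phaseCenter c + d)..1,
      Complex.exp (t * (c * u + quicksortG u : ℝ) * Complex.I)‖ ≤ 1 / (4 * |t| * d) := by
  have h0 := phaseCenter_mem c
  have ht' : 0 < |t| := abs_pos.2 ht
  rcases h1.eq_or_lt with h1 | h1
  · rw [h1, intervalIntegral.integral_same, norm_zero]
    positivity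
  have hcont : Continuous fun u : ℝ =>
      Complex.exp (t * (c * u + quicksortG u : ℝ) * Complex.I) := by
    have := continuous_quicksortG
    fun_prop
  have hlim : Filter.Tendsto (fun b => ‖∫ u in (phaseCenter c + d)..b,
      Complex.exp (t * (c * u + quicksortG u : ℝ) * Complex.I)‖) (nhdsWithin 1 (Set.Iio 1))
      (nhds ‖∫ u in (phaseCenter c + d)..1,
        Complex.exp (t * (c * u + quicksortG u : ℝ) * Complex.I)‖) := by
    apply Filter.Tendsto.norm
    exact ((intervalIntegral.continuous_primitive (fun a b => hcont.intervalIntegrable a b)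
      _).tendsto 1).mono_left nhdsWithin_le_nhds
  refine le_of_tendsto hlim ?_
  filter_upwards [Ioo_mem_nhdsLT h1] with b hb
  have hI : ∀ x ∈ Set.Icc (phaseCenter c + d) b, x ∈ Set.Ioo (0 : ℝ) 1 := fun x hx =>
    ⟨by linarith [h0.1, hx.1], hx.2.trans_lt hb.2⟩
  refine (norm_integral_exp_le_of_deriv (h := fun u => c * u + quicksortG u)
    (h' := fun u => c + (2 * Real.log u - 2 * Real.log (1 - u)))
    (h'' := fun u => 2 / u + 2 / (1 - u)) (l := 8 * d) hb.1.le (by positivity) ht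
    ?_ ?_ ?_ ?_ (mul_le_deriv_phase hd h1)).trans_eq ?_
  · intro x hx
    simpa using ((hasDerivAt_id' x).const_mul c).fun_add (hasDerivAt_quicksortG (hI x hx))
  · intro x hx
    exact (hasDerivAt_deriv_quicksortG (hI x hx)).const_add c
  · intro x hx
    have h2 := (hI x hx).1.ne'
    have h3 : 1 - x ≠ 0 := sub_ne_zero.2 (hI x hx).2.ne'
    exact ContinuousAt.continuousWithinAt (by fun_prop (disch := assumption))
  · intro x hx
    linarith [eight_le_deriv2_quicksortG (hI x hx)]
  · field_simp
    norm_num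

theorem norm_integral_exp_phase_left {c d t : ℝ} (hd : 0 < d) (ht : t ≠ 0)
    (h1 : 0 ≤ phaseCenter c - d) :
    ‖∫ u in 0..(phaseCenter c - d),
      Complex.exp (t * (c * u + quicksortG u : ℝ) * Complex.I)‖ ≤ 1 / (4 * |t| * d) := by
  have key := norm_integral_exp_phase_right (c := -c) hd ht
    (by rw [phaseCenter_neg]; linarith)
  have e := intervalIntegral.integral_comp_sub_left
    (fun u : ℝ => Complex.exp (t * (c * u + quicksortG u : ℝ) * Complex.I)) 1
    (a := phaseCenter (-c) + d) (b := 1)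
  rw [phaseCenter_neg, sub_self, show 1 - (1 - phaseCenter c + d) = phaseCenter c - d by ring] at e
  rw [← e]
  have e2 : ∀ u : ℝ, Complex.exp (t * (c * (1 - u) + quicksortG (1 - u) : ℝ) * Complex.I) =
      Complex.exp ((t * c : ℝ) * Complex.I) *
        Complex.exp (t * (-c * u + quicksortG u : ℝ) * Complex.I) := by
    intro u
    rw [← Complex.exp_add, quicksortG_one_sub]
    congr 1
    push_cast
    ring
  simp_rw [e2]
  rw [intervalIntegral.integral_const_mul, norm_mul, Complex.norm_exp_ofReal_mul_I, one_mul]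
  rwa [phaseCenter_neg] at key

/-- Second-derivative van der Corput estimate for the Quicksort phase. -/
theorem norm_integral_exp_phase_le (c : ℝ) {t : ℝ} (ht : t ≠ 0) :
    ‖∫ u in (0 : ℝ)..1, Complex.exp (t * (c * u + quicksortG u : ℝ) * Complex.I)‖ ≤
      2 / Real.sqrt |t| := by
  have h0 := phaseCenter_mem c
  have ht' : 0 < |t| := abs_pos.2 ht
  have hs : 0 < Real.sqrt |t| := Real.sqrt_pos.2 ht'
  set f : ℝ → ℂ := fun u => Complex.exp (t * (c * u + quicksortG u : ℝ) * Complex.I) with hf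
  have hcont : Continuous f := by
    have := continuous_quicksortG
    fun_prop
  have hn : ∀ u, ‖f u‖ ≤ 1 := fun u => by
    simp only [hf]
    rw [← Complex.ofReal_mul]
    exact (Complex.norm_exp_ofReal_mul_I _).le
  set d : ℝ := 1 / (2 * Real.sqrt |t|) with hd
  have hd0 : 0 < d := by positivity
  have hB : 1 / (4 * |t| * d) = 1 / (2 * Real.sqrt |t|) := by
    rw [hd]
    nth_rewrite 1 [← Real.sq_sqrt ht'.le]
    field_simp
    norm_num
  have hi : ∀ a b, IntervalIntegrable f volume a b := fun a b => hcont.intervalIntegrable a b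
  obtain ⟨α, hα, hα1, hα2⟩ : ∃ α, ‖∫ u in (0 : ℝ)..α, f u‖ ≤ 1 / (4 * |t| * d) ∧
      phaseCenter c - d ≤ α ∧ α ≤ phaseCenter c := by
    rcases le_total 0 (phaseCenter c - d) with h | h
    · exact ⟨_, norm_integral_exp_phase_left hd0 ht h, le_rfl, by linarith⟩
    · exact ⟨0, by rw [intervalIntegral.integral_same, norm_zero]; positivity, h, h0.1.le⟩
  obtain ⟨β, hβ, hβ1, hβ2⟩ : ∃ β, ‖∫ u in β..(1 : ℝ), f u‖ ≤ 1 / (4 * |t| * d) ∧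
      β ≤ phaseCenter c + d ∧ phaseCenter c ≤ β := by
    rcases le_total (phaseCenter c + d) 1 with h | h
    · exact ⟨_, norm_integral_exp_phase_right hd0 ht h, le_rfl, by linarith⟩
    · exact ⟨1, by rw [intervalIntegral.integral_same, norm_zero]; positivity, h, h0.2.le⟩
  have hm : ‖∫ u in α..β, f u‖ ≤ 2 * d := by
    have := intervalIntegral.norm_integral_le_of_norm_le_const (a := α) (b := β) (C := 1)
      (f := f) (fun u _ => hn u)
    rw [abs_of_nonneg (by linarith)] at this
    linarith
  rw [← intervalIntegral.integral_add_adjacent_intervals (hi 0 β) (hi β 1),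
    ← intervalIntegral.integral_add_adjacent_intervals (hi 0 α) (hi α β)]
  have h3 := (norm_add_le (∫ u in (0 : ℝ)..α, f u) (∫ u in α..β, f u))
  have h4 := (norm_add_le ((∫ u in (0 : ℝ)..α, f u) + ∫ u in α..β, f u) (∫ u in β..1, f u))
  have h5 : 2 / Real.sqrt |t| = 1 / (2 * Real.sqrt |t|) + 2 * d + 1 / (2 * Real.sqrt |t|) := by
    rw [hd]; field_simp; norm_num
  rw [h5]
  rw [hB] at hα hβ
  linarith

instance isProbabilityMeasure_restrict_Ioo :
    IsProbabilityMeasure (volume.restrict (Set.Ioo (0 : ℝ) 1)) := ⟨by simp⟩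

theorem isProbabilityMeasure_iterate_quicksortOp (G : Measure ℝ) [IsProbabilityMeasure G] (n : ℕ) :
    IsProbabilityMeasure (quicksortOp^[n] G) := by
  induction n with
  | zero => simpa
  | succ n ih =>
    rw [Function.iterate_succ_apply']
    infer_instance

theorem measurable_quicksortMap :
    Measurable fun p : ℝ × ℝ × ℝ => p.1 * p.2.1 + (1 - p.1) * p.2.2 + quicksortG p.1 := by
  have := measurable_quicksortG
  fun_prop

theorem norm_exp_mul_mul_I (a b : ℝ) : ‖Complex.exp (a * b * Complex.I)‖ = 1 := by
  rw [← Complex.ofReal_mul, Complex.norm_exp_ofReal_mul_I]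

theorem integrable_exp_comp {α : Type*} [MeasurableSpace α] {μ : Measure α} [IsFiniteMeasure μ]
    (t : ℝ) {f : α → ℝ} (hf : Measurable f) :
    Integrable (fun a => Complex.exp (t * f a * Complex.I)) μ := by
  refine Integrable.of_bound (C := 1) (by fun_prop) (Filter.Eventually.of_forall fun a => ?_)
  rw [norm_exp_mul_mul_I]

theorem charFun_quicksortOp_eq_prod (G : Measure ℝ) [IsProbabilityMeasure G] (t : ℝ) :
    charFun (quicksortOp G) t = ∫ p, Complex.exp
      (t * (p.1 * p.2.1 + (1 - p.1) * p.2.2 + quicksortG p.1 : ℝ) * Complex.I)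
      ∂((volume.restrict (Set.Ioo (0 : ℝ) 1)).prod (G.prod G)) := by
  rw [charFun_apply_real, quicksortOp, integral_map measurable_quicksortMap.aemeasurable
    (by fun_prop)]

theorem charFun_quicksortOp (G : Measure ℝ) [IsProbabilityMeasure G] (t : ℝ) :
    charFun (quicksortOp G) t = ∫ u in Set.Ioo (0 : ℝ) 1,
      charFun G (t * u) * charFun G (t * (1 - u)) *
        Complex.exp (t * quicksortG u * Complex.I) := by
  rw [charFun_quicksortOp_eq_prod, integral_prod _ (integrable_exp_comp t measurable_quicksortMap)]
  congr 1
  funext u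
  rw [charFun_apply_real, charFun_apply_real, ← integral_prod_mul, ← integral_mul_const]
  congr 1
  funext q
  rw [← Complex.exp_add, ← Complex.exp_add]
  congr 1
  push_cast
  ring

theorem norm_charFun_quicksortOp_le (G : Measure ℝ) [IsProbabilityMeasure G] {t : ℝ}
    (ht : t ≠ 0) : ‖charFun (quicksortOp G) t‖ ≤ 2 / Real.sqrt |t| := by
  rw [charFun_quicksortOp_eq_prod,
    integral_prod_symm _ (integrable_exp_comp t measurable_quicksortMap)]
  refine (norm_integral_le_of_norm_le_const (C := 2 / Real.sqrt |t|)
    (Filter.Eventually.of_forall fun q => ?_)).trans_eq (by simp)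
  have e : ∀ u : ℝ, Complex.exp
      (t * (u * q.1 + (1 - u) * q.2 + quicksortG u : ℝ) * Complex.I) =
      Complex.exp ((t * q.2 : ℝ) * Complex.I) *
        Complex.exp (t * ((q.1 - q.2) * u + quicksortG u : ℝ) * Complex.I) := by
    intro u
    rw [← Complex.exp_add]
    congr 1
    push_cast
    ring
  simp_rw [e]
  rw [integral_const_mul, norm_mul, Complex.norm_exp_ofReal_mul_I, one_mul,
    ← integral_Ioc_eq_integral_Ioo, ← intervalIntegral.integral_of_le zero_le_one]
  exact norm_integral_exp_phase_le _ ht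

theorem intervalIntegrable_inv_sqrt :
    IntervalIntegrable (fun u : ℝ => (Real.sqrt u)⁻¹) volume 0 1 := by
  have h := intervalIntegral.intervalIntegrable_rpow' (a := 0) (b := 1)
    (show (-1 : ℝ) < -(1 / 2) by norm_num)
  refine h.congr fun u hu => ?_
  rw [Set.uIoc_of_le zero_le_one] at hu
  rw [Real.sqrt_eq_rpow, Real.rpow_neg hu.1.le]

theorem integral_inv_sqrt : ∫ u in (0 : ℝ)..1, (Real.sqrt u)⁻¹ = 2 := by
  have e : ∫ u in (0 : ℝ)..1, (Real.sqrt u)⁻¹ = ∫ u in (0 : ℝ)..1, u ^ (-(1 / 2) : ℝ) := by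
    apply intervalIntegral.integral_congr
    intro u hu
    rw [Set.uIcc_of_le zero_le_one] at hu
    simp only
    rw [Real.sqrt_eq_rpow, Real.rpow_neg hu.1]
  rw [e, integral_rpow (Or.inl (by norm_num))]
  norm_num

theorem intervalIntegrable_inv_sqrt_one_sub :
    IntervalIntegrable (fun u : ℝ => (Real.sqrt (1 - u))⁻¹) volume 0 1 := by
  simpa using (intervalIntegrable_inv_sqrt.comp_sub_left 1).symm

theorem integral_inv_sqrt_one_sub : ∫ u in (0 : ℝ)..1, (Real.sqrt (1 - u))⁻¹ = 2 := by
  rw [intervalIntegral.integral_comp_sub_left (fun u => (Real.sqrt u)⁻¹)]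
  simpa using integral_inv_sqrt

theorem mul_le_of_decay {φ : ℝ → ℝ} {c : ℝ} {k : ℕ} (hφ : ∀ t, 0 ≤ φ t) (hc : 0 ≤ c)
    (h1 : ∀ t ≠ 0, φ t ≤ 2 / Real.sqrt |t|) (h2 : ∀ t ≠ 0, φ t ≤ c / Real.sqrt |t| ^ k)
    {t u : ℝ} (ht : t ≠ 0) (hu : 0 < u) (hu' : u ≤ 1 / 2) :
    φ (t * u) * φ (t * (1 - u)) ≤
      2 * c * Real.sqrt 2 ^ k / Real.sqrt |t| ^ (k + 1) * (Real.sqrt u)⁻¹ := by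
  have ht' : 0 < Real.sqrt |t| := Real.sqrt_pos.2 (abs_pos.2 ht)
  have hsu : 0 < Real.sqrt u := Real.sqrt_pos.2 hu
  have h3 : φ (t * u) ≤ 2 / (Real.sqrt |t| * Real.sqrt u) := by
    have := h1 (t * u) (mul_ne_zero ht hu.ne')
    rwa [abs_mul, abs_of_pos hu, Real.sqrt_mul (abs_nonneg t)] at this
  have hs1 : 0 < Real.sqrt (1 - u) := Real.sqrt_pos.2 (by linarith)
  have h4 : φ (t * (1 - u)) ≤ c * Real.sqrt 2 ^ k / Real.sqrt |t| ^ k := by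
    have := h2 (t * (1 - u)) (mul_ne_zero ht (by linarith))
    rw [abs_mul, abs_of_pos (show 0 < 1 - u by linarith), Real.sqrt_mul (abs_nonneg t)] at this
    refine this.trans ?_
    rw [mul_pow, div_le_div_iff₀ (by positivity) (by positivity)]
    have h5 : 1 ≤ Real.sqrt 2 * Real.sqrt (1 - u) := by
      rw [← Real.sqrt_mul (by norm_num)]
      exact Real.one_le_sqrt.2 (by linarith)
    have h6 := one_le_pow₀ h5 (n := k)
    rw [mul_pow] at h6
    have h7 : 0 ≤ c * Real.sqrt |t| ^ k := by positivity
    nlinarith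
  calc _ ≤ 2 / (Real.sqrt |t| * Real.sqrt u) * (c * Real.sqrt 2 ^ k / Real.sqrt |t| ^ k) := by
        gcongr
        exact hφ _
    _ = _ := by field_simp; ring

theorem norm_charFun_quicksortOp_le_of_decay (G : Measure ℝ) [IsProbabilityMeasure G] {c : ℝ}
    {k : ℕ} (hc : 0 ≤ c) (h1 : ∀ t ≠ 0, ‖charFun G t‖ ≤ 2 / Real.sqrt |t|)
    (h2 : ∀ t ≠ 0, ‖charFun G t‖ ≤ c / Real.sqrt |t| ^ k) {t : ℝ} (ht : t ≠ 0) :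
    ‖charFun (quicksortOp G) t‖ ≤ 8 * Real.sqrt 2 ^ k * c / Real.sqrt |t| ^ (k + 1) := by
  have ht' : 0 < Real.sqrt |t| := Real.sqrt_pos.2 (abs_pos.2 ht)
  set B := 2 * c * Real.sqrt 2 ^ k / Real.sqrt |t| ^ (k + 1) with hB
  have hB0 : 0 ≤ B := by positivity
  rw [charFun_quicksortOp, ← integral_Ioc_eq_integral_Ioo,
    ← intervalIntegral.integral_of_le zero_le_one]
  have hle : ‖∫ u in (0 : ℝ)..1, charFun G (t * u) * charFun G (t * (1 - u)) *
      Complex.exp (t * quicksortG u * Complex.I)‖ ≤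
      ∫ u in (0 : ℝ)..1, B * ((Real.sqrt u)⁻¹ + (Real.sqrt (1 - u))⁻¹) := by
    refine intervalIntegral.norm_integral_le_of_norm_le zero_le_one ?_
      ((intervalIntegrable_inv_sqrt.add intervalIntegrable_inv_sqrt_one_sub).const_mul B)
    have hne : ∀ᵐ u : ℝ, u ≠ 1 := by simp [ae_iff]
    filter_upwards [hne] with u hu1 hu
    rw [norm_mul, norm_mul, norm_exp_mul_mul_I, mul_one]
    have hi1 : 0 ≤ (Real.sqrt u)⁻¹ := by positivity
    have hi2 : 0 ≤ (Real.sqrt (1 - u))⁻¹ := by positivity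
    rcases le_total u (1 / 2) with h | h
    · have := mul_le_of_decay (φ := fun t => ‖charFun G t‖) (fun _ => norm_nonneg _) hc h1 h2
        ht hu.1 h
      nlinarith
    · have := mul_le_of_decay (φ := fun t => ‖charFun G t‖) (fun _ => norm_nonneg _) hc h1 h2
        ht (sub_pos.2 (lt_of_le_of_ne hu.2 hu1)) (by linarith)
      rw [sub_sub_cancel] at this
      nlinarith
  refine hle.trans_eq ?_
  rw [intervalIntegral.integral_const_mul, intervalIntegral.integral_add
    intervalIntegrable_inv_sqrt intervalIntegrable_inv_sqrt_one_sub, integral_inv_sqrt,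
    integral_inv_sqrt_one_sub, hB]
  ring

/-- Constants in the decay estimates of characteristic functions of iterates. -/
noncomputable def decayConst : ℕ → ℝ
  | 0 => 2
  | n + 1 => 8 * Real.sqrt 2 ^ (n + 1) * decayConst n

theorem decayConst_nonneg (n : ℕ) : 0 ≤ decayConst n := by
  induction n with
  | zero => simp [decayConst]
  | succ n ih => rw [decayConst]; positivity

theorem norm_charFun_iterate_le (n : ℕ) (G : Measure ℝ) [IsProbabilityMeasure G] {t : ℝ}
    (ht : t ≠ 0) :
    ‖charFun (quicksortOp^[n + 1] G) t‖ ≤ decayConst n / Real.sqrt |t| ^ (n + 1) := by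
  induction n generalizing t with
  | zero => simpa [decayConst] using norm_charFun_quicksortOp_le G ht
  | succ n ih =>
    rw [Function.iterate_succ_apply', decayConst]
    have := isProbabilityMeasure_iterate_quicksortOp G (n + 1)
    refine norm_charFun_quicksortOp_le_of_decay _ (decayConst_nonneg n) (fun t ht => ?_)
      (fun t ht => ih ht) ht
    have := isProbabilityMeasure_iterate_quicksortOp G n
    rw [Function.iterate_succ_apply']
    exact norm_charFun_quicksortOp_le _ ht

theorem decayConst_nine_le : decayConst 9 ≤ 2 ^ 51 := by
  have h : decayConst 9 = 2 ^ 28 * Real.sqrt 2 ^ 45 := by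
    simp only [decayConst]; ring
  have h2 : Real.sqrt 2 ^ 45 = 2 ^ 22 * Real.sqrt 2 := by
    rw [show 45 = 2 * 22 + 1 by norm_num, pow_succ, pow_mul, Real.sq_sqrt (by norm_num)]
  have h3 : Real.sqrt 2 ≤ 2 := by
    rw [Real.sqrt_le_left (by norm_num)]; norm_num
  rw [h, h2]
  linarith

theorem norm_charFun_iterate_le_of_ten_le {n : ℕ} (hn : 10 ≤ n) (G : Measure ℝ)
    [IsProbabilityMeasure G] {t : ℝ} (ht : t ≠ 0) :
    ‖charFun (quicksortOp^[n] G) t‖ ≤ 2 ^ 51 / |t| ^ 5 := by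
  obtain ⟨m, rfl⟩ := Nat.exists_eq_add_of_le hn
  rw [Function.iterate_add_apply]
  have := isProbabilityMeasure_iterate_quicksortOp G m
  refine (norm_charFun_iterate_le 9 (quicksortOp^[m] G) ht).trans ?_
  rw [show Real.sqrt |t| ^ (9 + 1) = |t| ^ 5 by
    rw [show 9 + 1 = 2 * 5 by norm_num, pow_mul, Real.sq_sqrt (abs_nonneg t)]]
  gcongr
  exact decayConst_nine_le

theorem abs_quicksortG_le_one {u : ℝ} (h0 : 0 ≤ u) (h1 : u ≤ 1) : |quicksortG u| ≤ 1 := by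
  rw [quicksortG_eq, abs_le]
  have := Real.binEntropy_nonneg h0 h1
  have := Real.binEntropy_le_log_two (p := u)
  have := Real.log_two_lt_d9
  constructor <;> linarith

theorem integral_mul_log_zero_one : ∫ u in (0 : ℝ)..1, u * Real.log u = -(1 / 4) := by
  have hc := Real.continuous_mul_log
  rw [intervalIntegral.integral_eq_sub_of_hasDerivAt_of_le (a := 0) (b := 1)
    (f := fun u : ℝ => u * (u * Real.log u) / 2 - u ^ 2 / 4) zero_le_one
    (by fun_prop) (fun u hu => ?_) (hc.intervalIntegrable _ _)]
  · norm_num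
  · have h1 := ((hasDerivAt_id' u).fun_mul
      ((hasDerivAt_id' u).fun_mul (Real.hasDerivAt_log hu.1.ne'))).div_const 2
    have h2 := (hasDerivAt_pow 2 u).div_const 4
    convert! h1.fun_sub h2 using 1
    have := hu.1.ne'
    field_simp
    ring

theorem integral_quicksortG : ∫ u in Set.Ioo (0 : ℝ) 1, quicksortG u = 0 := by
  rw [← integral_Ioc_eq_integral_Ioo, ← intervalIntegral.integral_of_le zero_le_one]
  have hc := Real.continuous_mul_log
  have hc' : Continuous fun u : ℝ => (1 - u) * Real.log (1 - u) :=
    hc.comp (continuous_const.sub continuous_id)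
  have e : quicksortG = fun u : ℝ => (2 * (u * Real.log u) + 2 * ((1 - u) * Real.log (1 - u))) + 1 := by
    funext u; rw [quicksortG]; ring
  have h := intervalIntegral.integral_comp_sub_left (fun u : ℝ => u * Real.log u) 1 (a := 0) (b := 1)
  rw [sub_zero, sub_self, integral_mul_log_zero_one] at h
  have hcc : Continuous fun u : ℝ => 2 * (u * Real.log u) + 2 * ((1 - u) * Real.log (1 - u)) :=
    (hc.const_mul 2).add (hc'.const_mul 2)
  simp only [e]
  rw [intervalIntegral.integral_add (hcc.intervalIntegrable _ _) (by simp),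
    intervalIntegral.integral_add ((hc.const_mul 2).intervalIntegrable _ _)
      ((hc'.const_mul 2).intervalIntegrable _ _), intervalIntegral.integral_const_mul,
    intervalIntegral.integral_const_mul, integral_mul_log_zero_one, h]
  norm_num

/-- The variance `∫ g²` of the toll term. -/
noncomputable def tollVar : ℝ := ∫ u in Set.Ioo (0 : ℝ) 1, quicksortG u ^ 2

theorem integrable_quicksortG_sq :
    Integrable (fun u => quicksortG u ^ 2) (volume.restrict (Set.Ioo (0 : ℝ) 1)) := by
  have : Continuous fun u => quicksortG u ^ 2 := continuous_quicksortG.pow 2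
  exact (this.integrableOn_Icc (a := 0) (b := 1)).mono_set Set.Ioo_subset_Icc_self

theorem tollVar_le_one : tollVar ≤ 1 := by
  have h : tollVar ≤ ∫ u in Set.Ioo (0 : ℝ) 1, (1 : ℝ) := by
    refine setIntegral_mono_on integrable_quicksortG_sq (integrable_const _) measurableSet_Ioo
      fun u hu => ?_
    rw [← sq_abs]
    exact pow_le_one₀ (abs_nonneg _) (abs_quicksortG_le_one hu.1.le hu.2.le)
  simpa using h

theorem half_le_quicksortG {u : ℝ} (h0 : 0 < u) (h1 : u < 1 / 64) : 1 / 2 ≤ quicksortG u := by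
  set s := Real.sqrt u with hs
  have hs0 : 0 < s := Real.sqrt_pos.2 h0
  have hu : u = s ^ 2 := (Real.sq_sqrt h0.le).symm
  have hs1 : s < 1 / 8 := by
    rw [hs, Real.sqrt_lt' (by norm_num)]; linarith
  have l1 := Real.log_le_sub_one_of_pos (inv_pos.2 hs0)
  rw [Real.log_inv] at l1
  have h1u : 0 < 1 - u := by linarith
  have l2 := Real.log_le_sub_one_of_pos (inv_pos.2 h1u)
  rw [Real.log_inv] at l2
  have e1 : Real.log u = 2 * Real.log s := by rw [hu, Real.log_pow]; norm_num
  have e4 : -(2 * u) ≤ 2 * (1 - u) * Real.log (1 - u) := by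
    have : 2 * (1 - u) * (-Real.log (1 - u)) ≤ 2 * (1 - u) * ((1 - u)⁻¹ - 1) := by gcongr
    have e5 : (1 - u) * (1 - u)⁻¹ = 1 := mul_inv_cancel₀ h1u.ne'
    nlinarith
  rw [quicksortG]
  have : u ≤ 1 / 64 := h1.le
  have e6 : 2 * u * Real.log u ≥ -(4 * s) + 4 * u := by
    rw [e1]
    have : 4 * u * (-Real.log s) ≤ 4 * u * (s⁻¹ - 1) := by gcongr
    have e3 : u * s⁻¹ = s := by rw [hu]; field_simp
    nlinarith
  linarith

theorem le_tollVar : 1 / 256 ≤ tollVar := by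
  have hsub : Set.Ioo (0 : ℝ) (1 / 64) ⊆ Set.Ioo 0 1 := Set.Ioo_subset_Ioo_right (by norm_num)
  have h1 : ∫ u in Set.Ioo (0 : ℝ) (1 / 64), quicksortG u ^ 2 ≤ tollVar :=
    setIntegral_mono_set integrable_quicksortG_sq
      (Filter.Eventually.of_forall fun u => sq_nonneg _) hsub.eventuallyLE
  have h2 : ∫ u in Set.Ioo (0 : ℝ) (1 / 64), (1 / 4 : ℝ) ≤
      ∫ u in Set.Ioo (0 : ℝ) (1 / 64), quicksortG u ^ 2 := by
    refine setIntegral_mono_on (by simp) (integrable_quicksortG_sq.mono_measure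
      (Measure.restrict_mono hsub le_rfl)) measurableSet_Ioo fun u hu => ?_
    nlinarith [half_le_quicksortG hu.1 hu.2]
  rw [setIntegral_const, Real.volume_real_Ioo_of_le (by norm_num)] at h2
  norm_num at h2 ⊢
  linarith

theorem integrable_sq_of_memLp_two {G : Measure ℝ} (hG : MemLp id 2 G) :
    Integrable (fun x => x ^ 2) G :=
  hG.integrable_sq

section Moments

variable {G : Measure ℝ} [IsProbabilityMeasure G]

theorem memLp_quicksortMap (hG : MemLp id 2 G) :
    MemLp (fun p : ℝ × ℝ × ℝ => p.1 * p.2.1 + (1 - p.1) * p.2.2 + quicksortG p.1) 2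
      ((volume.restrict (Set.Ioo (0 : ℝ) 1)).prod (G.prod G)) := by
  have hg := measurable_quicksortG
  have hu : ∀ᵐ p : ℝ × ℝ × ℝ ∂((volume.restrict (Set.Ioo (0 : ℝ) 1)).prod (G.prod G)),
      p.1 ∈ Set.Ioo (0 : ℝ) 1 :=
    Measure.quasiMeasurePreserving_fst.ae (ae_restrict_mem measurableSet_Ioo)
  have ha : MemLp (fun p : ℝ × ℝ × ℝ => p.2.1) 2
      ((volume.restrict (Set.Ioo (0 : ℝ) 1)).prod (G.prod G)) :=
    (hG.comp_fst G).comp_snd (volume.restrict (Set.Ioo (0 : ℝ) 1))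
  have hb : MemLp (fun p : ℝ × ℝ × ℝ => p.2.2) 2
      ((volume.restrict (Set.Ioo (0 : ℝ) 1)).prod (G.prod G)) :=
    (hG.comp_snd G).comp_snd (volume.restrict (Set.Ioo (0 : ℝ) 1))
  have ha' : MemLp (fun p : ℝ × ℝ × ℝ => p.1 * p.2.1) 2
      ((volume.restrict (Set.Ioo (0 : ℝ) 1)).prod (G.prod G)) := by
    refine ha.of_le (by fun_prop) ?_
    filter_upwards [hu] with p hp
    rw [norm_mul, Real.norm_of_nonneg hp.1.le]
    exact mul_le_of_le_one_left (norm_nonneg _) hp.2.le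
  have hb' : MemLp (fun p : ℝ × ℝ × ℝ => (1 - p.1) * p.2.2) 2
      ((volume.restrict (Set.Ioo (0 : ℝ) 1)).prod (G.prod G)) := by
    refine hb.of_le (by fun_prop) ?_
    filter_upwards [hu] with p hp
    rw [norm_mul, Real.norm_of_nonneg (sub_pos.2 hp.2).le]
    exact mul_le_of_le_one_left (norm_nonneg _) (by linarith [hp.1])
  have hg' : MemLp (fun p : ℝ × ℝ × ℝ => quicksortG p.1) 2
      ((volume.restrict (Set.Ioo (0 : ℝ) 1)).prod (G.prod G)) := by
    refine MemLp.of_bound (hg.comp measurable_fst).aestronglyMeasurable 1 ?_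
    filter_upwards [hu] with p hp
    exact abs_quicksortG_le_one hp.1.le hp.2.le
  exact (ha'.add hb').add hg'

theorem memLp_quicksortOp (hG : MemLp id 2 G) : MemLp id 2 (quicksortOp G) := by
  rw [quicksortOp, memLp_map_measure_iff (by fun_prop) measurable_quicksortMap.aemeasurable]
  exact memLp_quicksortMap hG

theorem integrable_id_of_memLp_two (hG : MemLp id 2 G) : Integrable (fun x => x) G :=
  hG.integrable (by norm_num)

theorem integral_quicksortOp_id (hG : MemLp id 2 G) (h0 : ∫ x, x ∂G = 0) :
    ∫ x, x ∂(quicksortOp G) = 0 := by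
  have hi := integrable_id_of_memLp_two hG
  rw [quicksortOp, integral_map measurable_quicksortMap.aemeasurable (by fun_prop),
    integral_prod _ ((memLp_quicksortMap hG).integrable (by norm_num))]
  refine Eq.trans ?_ integral_quicksortG
  refine integral_congr_ae (Filter.Eventually.of_forall fun u => ?_)
  simp only
  have i1 : Integrable (fun q : ℝ × ℝ => u * q.1) (G.prod G) := (hi.comp_fst G).const_mul u
  have i2 : Integrable (fun q : ℝ × ℝ => (1 - u) * q.2) (G.prod G) :=
    (hi.comp_snd G).const_mul (1 - u)
  have i3 : Integrable (fun q : ℝ × ℝ => u * q.1 + (1 - u) * q.2) (G.prod G) := i1.add i2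
  rw [integral_add i3 (integrable_const _), integral_add i1 i2, integral_const_mul,
    integral_const_mul, integral_fun_fst (μ := G) (ν := G) (fun x : ℝ => x),
    integral_fun_snd (μ := G) (ν := G) (fun x : ℝ => x), h0]
  simp

theorem integral_affine_sq (hG : MemLp id 2 G) (h0 : ∫ x, x ∂G = 0) (α β : ℝ) :
    ∫ x, (α + β * x) ^ 2 ∂G = α ^ 2 + β ^ 2 * ∫ x, x ^ 2 ∂G := by
  have hi := integrable_id_of_memLp_two hG
  have hi2 := integrable_sq_of_memLp_two hG
  have e : ∀ x : ℝ, (α + β * x) ^ 2 = α ^ 2 + (2 * α * β) * x + β ^ 2 * x ^ 2 := fun x => by ring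
  simp_rw [e]
  have i3 : Integrable (fun x : ℝ => α ^ 2 + (2 * α * β) * x) G :=
    (integrable_const _).add (hi.const_mul _)
  rw [integral_add i3 (hi2.const_mul _),
    integral_add (integrable_const _) (hi.const_mul _), integral_const_mul, integral_const_mul, h0]
  simp

theorem integral_quicksortOp_sq (hG : MemLp id 2 G) (h0 : ∫ x, x ∂G = 0) :
    ∫ x, x ^ 2 ∂(quicksortOp G) = 2 / 3 * ∫ x, x ^ 2 ∂G + tollVar := by
  rw [quicksortOp, integral_map measurable_quicksortMap.aemeasurable (by fun_prop),
    integral_prod _ (memLp_quicksortMap hG).integrable_sq]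
  have e : ∀ u : ℝ, ∫ q : ℝ × ℝ, (u * q.1 + (1 - u) * q.2 + quicksortG u) ^ 2 ∂(G.prod G) =
      (u ^ 2 + (1 - u) ^ 2) * (∫ x, x ^ 2 ∂G) + quicksortG u ^ 2 := by
    intro u
    have i1 : MemLp (fun q : ℝ × ℝ => u * q.1) 2 (G.prod G) := (hG.comp_fst G).const_mul u
    have i2 : MemLp (fun q : ℝ × ℝ => (1 - u) * q.2) 2 (G.prod G) :=
      (hG.comp_snd G).const_mul (1 - u)
    have i3 : MemLp (fun q : ℝ × ℝ => u * q.1 + (1 - u) * q.2 + quicksortG u) 2 (G.prod G) :=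
      (i1.add i2).add (memLp_const (quicksortG u))
    rw [integral_prod _ i3.integrable_sq]
    have e1 : ∀ x : ℝ, ∫ y, (u * x + (1 - u) * y + quicksortG u) ^ 2 ∂G =
        (quicksortG u + u * x) ^ 2 + (1 - u) ^ 2 * ∫ x, x ^ 2 ∂G := by
      intro x
      rw [← integral_affine_sq hG h0]
      congr 1
      funext y
      ring
    simp_rw [e1]
    rw [integral_add _ (integrable_const _), integral_affine_sq hG h0]
    · simp
      ring
    · exact ((memLp_const (quicksortG u)).add (hG.const_mul u)).integrable_sq
  simp_rw [e]
  have hc : Continuous fun u : ℝ => u ^ 2 + (1 - u) ^ 2 := by fun_prop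
  have hci : Integrable (fun u : ℝ => u ^ 2 + (1 - u) ^ 2)
      (volume.restrict (Set.Ioo (0 : ℝ) 1)) :=
    (hc.integrableOn_Icc (a := 0) (b := 1)).mono_set Set.Ioo_subset_Icc_self
  rw [integral_add (hci.mul_const _) integrable_quicksortG_sq, integral_mul_const, ← tollVar]
  congr 2
  rw [← integral_Ioc_eq_integral_Ioo, ← intervalIntegral.integral_of_le zero_le_one,
    intervalIntegral.integral_add (by simp) (Continuous.intervalIntegrable (by fun_prop) _ _),
    intervalIntegral.integral_comp_sub_left (fun u : ℝ => u ^ 2)]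
  simp only [integral_pow]
  norm_num

theorem moments_iterate_quicksortOp (hG : MemLp id 2 G) (h0 : ∫ x, x ∂G = 0) (n : ℕ) :
    MemLp id 2 (quicksortOp^[n] G) ∧ ∫ x, x ∂(quicksortOp^[n] G) = 0 ∧
      ∫ x, x ^ 2 ∂(quicksortOp^[n] G) ≤ (2 / 3) ^ n * ∫ x, x ^ 2 ∂G + 3 := by
  induction n with
  | zero => simp [hG, h0]
  | succ n ih =>
    have := isProbabilityMeasure_iterate_quicksortOp G n
    rw [Function.iterate_succ_apply']
    refine ⟨memLp_quicksortOp ih.1, integral_quicksortOp_id ih.1 ih.2.1, ?_⟩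
    rw [integral_quicksortOp_sq ih.1 ih.2.1, pow_succ]
    linarith [ih.2.2, tollVar_le_one]

end Moments

theorem norm_exp_mul_I_sub_one_sub_le (x : ℝ) :
    ‖Complex.exp (x * Complex.I) - 1 - x * Complex.I‖ ≤ x ^ 2 / 2 := by
  have hf : ∀ s : ℝ, HasDerivAt
      (fun s : ℝ => Complex.exp ((s : ℂ) * (x * Complex.I)) - 1 - s * (x * Complex.I))
      ((Complex.exp ((s : ℂ) * (x * Complex.I)) - 1) * (x * Complex.I)) s := by
    intro s
    have h1 : HasDerivAt (fun s : ℝ => (s : ℂ) * (x * Complex.I)) (1 * (x * Complex.I)) s :=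
      (hasDerivAt_id' s).ofReal_comp.mul_const _
    convert! (h1.cexp.sub_const 1).fun_sub h1 using 1
    ring
  have hB : ∀ s : ℝ, HasDerivAt (fun s : ℝ => x ^ 2 * s ^ 2 / 2) (x ^ 2 * s) s := by
    intro s
    convert! (((hasDerivAt_pow 2 s).const_mul (x ^ 2)).div_const 2) using 1
    simp
    ring
  have := image_norm_le_of_norm_deriv_right_le_deriv_boundary (a := 0) (b := 1)
    (fun s _ => (hf s).continuousAt.continuousWithinAt) (fun s _ => (hf s).hasDerivWithinAt)
    (by simp) hB (fun s hs => ?_) (Set.right_mem_Icc.2 zero_le_one)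
  · simpa using this
  · have h2 : ‖Complex.exp ((s : ℂ) * (x * Complex.I)) - 1‖ ≤ |s * x| := by
      have := Real.norm_exp_I_mul_ofReal_sub_one_le (x := s * x)
      rwa [Real.norm_eq_abs, show Complex.I * ((s * x : ℝ) : ℂ) = (s : ℂ) * (x * Complex.I) by
        push_cast; ring] at this
    rw [norm_mul, norm_mul, Complex.norm_I, mul_one, Complex.norm_real, Real.norm_eq_abs]
    calc _ ≤ |s * x| * |x| := by gcongr
      _ = x ^ 2 * s := by rw [abs_mul, mul_assoc, abs_mul_abs_self, abs_of_nonneg hs.1]; ring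

theorem norm_charFun_sub_taylor_le {G : Measure ℝ} [IsProbabilityMeasure G] (hG : MemLp id 2 G)
    (t : ℝ) : ‖charFun G t - 1 - (t * ∫ x, x ∂G : ℝ) * Complex.I‖ ≤
      (∫ x, x ^ 2 ∂G) / 2 * t ^ 2 := by
  have hi := integrable_id_of_memLp_two hG
  have hi2 := integrable_sq_of_memLp_two hG
  have i1 : Integrable (fun x : ℝ => Complex.exp (t * x * Complex.I)) G :=
    integrable_exp_comp t measurable_id
  have i2 : Integrable (fun x : ℝ => ((t * x : ℝ) : ℂ) * Complex.I) G :=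
    ((hi.const_mul t).ofReal).mul_const _
  have i3 : Integrable (fun x : ℝ => Complex.exp (t * x * Complex.I) - 1) G :=
    i1.sub (integrable_const _)
  have e : charFun G t - 1 - (t * ∫ x, x ∂G : ℝ) * Complex.I =
      ∫ x : ℝ, (Complex.exp (t * x * Complex.I) - 1 - ((t * x : ℝ) : ℂ) * Complex.I) ∂G := by
    rw [integral_sub i3 i2, integral_sub i1 (integrable_const _), charFun_apply_real,
      integral_mul_const, integral_complex_ofReal, integral_const_mul]
    simp
  rw [e]
  refine (norm_integral_le_of_norm_le (hi2.const_mul (t ^ 2 / 2))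
    (Filter.Eventually.of_forall fun x => ?_)).trans_eq ?_
  · have := norm_exp_mul_I_sub_one_sub_le (t * x)
    rw [mul_pow] at this
    push_cast at this ⊢
    linarith
  · rw [integral_const_mul]; ring

theorem norm_charFun_sub_one_le {G : Measure ℝ} [IsProbabilityMeasure G] (hG : MemLp id 2 G)
    (h0 : ∫ x, x ∂G = 0) (t : ℝ) : ‖charFun G t - 1‖ ≤ (∫ x, x ^ 2 ∂G) / 2 * t ^ 2 := by
  simpa [h0] using norm_charFun_sub_taylor_le hG t

theorem integrable_charFun_quicksortOp (G : Measure ℝ) [IsProbabilityMeasure G] (t : ℝ) :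
    Integrable (fun u => charFun G (t * u) * charFun G (t * (1 - u)) *
        Complex.exp (t * quicksortG u * Complex.I)) (volume.restrict (Set.Ioo (0 : ℝ) 1)) := by
  have hg := measurable_quicksortG
  refine Integrable.of_bound (C := 1) (Measurable.aestronglyMeasurable ?_)
    (Filter.Eventually.of_forall fun u => ?_)
  · have h1 : Measurable fun u : ℝ => charFun G (t * u) :=
      measurable_charFun.comp (measurable_const_mul t)
    have h2 : Measurable fun u : ℝ => charFun G (t * (1 - u)) :=
      measurable_charFun.comp (by fun_prop)
    fun_prop
  · rw [norm_mul, norm_mul, norm_exp_mul_mul_I, mul_one]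
    exact mul_le_one₀ (norm_charFun_le_one _) (norm_nonneg _) (norm_charFun_le_one _)

theorem norm_charFun_quicksortOp_sub_le {G H : Measure ℝ} [IsProbabilityMeasure G]
    [IsProbabilityMeasure H] {D : ℝ} (h : ∀ t, ‖charFun G t - charFun H t‖ ≤ D * t ^ 2) (t : ℝ) :
    ‖charFun (quicksortOp G) t - charFun (quicksortOp H) t‖ ≤ 2 / 3 * D * t ^ 2 := by
  rw [charFun_quicksortOp, charFun_quicksortOp,
    ← integral_sub (integrable_charFun_quicksortOp G t) (integrable_charFun_quicksortOp H t)]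
  rw [← integral_Ioc_eq_integral_Ioo, ← intervalIntegral.integral_of_le zero_le_one]
  have hle := intervalIntegral.norm_integral_le_of_norm_le (μ := volume) (a := 0) (b := 1)
    (f := fun u : ℝ => charFun G (t * u) * charFun G (t * (1 - u)) *
        Complex.exp (t * quicksortG u * Complex.I) -
      charFun H (t * u) * charFun H (t * (1 - u)) * Complex.exp (t * quicksortG u * Complex.I))
    (g := fun u : ℝ => D * t ^ 2 * (u ^ 2 + (1 - u) ^ 2)) zero_le_one
    (Filter.Eventually.of_forall fun u _ => ?_) (Continuous.intervalIntegrable (by fun_prop) _ _)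
  · refine hle.trans_eq ?_
    rw [intervalIntegral.integral_const_mul, intervalIntegral.integral_add (by simp)
      (Continuous.intervalIntegrable (by fun_prop) _ _),
      intervalIntegral.integral_comp_sub_left (fun u : ℝ => u ^ 2)]
    simp only [integral_pow]
    norm_num
    ring
  · have e : charFun G (t * u) * charFun G (t * (1 - u)) *
        Complex.exp (t * quicksortG u * Complex.I) -
        charFun H (t * u) * charFun H (t * (1 - u)) * Complex.exp (t * quicksortG u * Complex.I) =
        (charFun G (t * u) * (charFun G (t * (1 - u)) - charFun H (t * (1 - u))) +
          (charFun G (t * u) - charFun H (t * u)) * charFun H (t * (1 - u))) *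
          Complex.exp (t * quicksortG u * Complex.I) := by ring
    rw [e, norm_mul, norm_exp_mul_mul_I, mul_one]
    refine (norm_add_le _ _).trans ?_
    rw [norm_mul, norm_mul]
    have h1 := mul_le_of_le_one_left (norm_nonneg (charFun G (t * (1 - u)) -
      charFun H (t * (1 - u)))) (norm_charFun_le_one (μ := G) (t * u))
    have h2 := mul_le_of_le_one_right (norm_nonneg (charFun G (t * u) - charFun H (t * u)))
      (norm_charFun_le_one (μ := H) (t * (1 - u)))
    have h3 := h (t * (1 - u))
    have h4 := h (t * u)
    nlinarith

theorem norm_charFun_iterate_sub_le {G H : Measure ℝ} [IsProbabilityMeasure G]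
    [IsProbabilityMeasure H] {D : ℝ} (h : ∀ t, ‖charFun G t - charFun H t‖ ≤ D * t ^ 2) (n : ℕ)
    (t : ℝ) :
    ‖charFun (quicksortOp^[n] G) t - charFun (quicksortOp^[n] H) t‖ ≤
      (2 / 3) ^ n * D * t ^ 2 := by
  induction n generalizing t with
  | zero => simpa using h t
  | succ n ih =>
    have := isProbabilityMeasure_iterate_quicksortOp G n
    have := isProbabilityMeasure_iterate_quicksortOp H n
    rw [Function.iterate_succ_apply', Function.iterate_succ_apply']
    exact (norm_charFun_quicksortOp_sub_le ih t).trans_eq (by ring)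

theorem norm_charFun_sub_charFun_le {G H : Measure ℝ} [IsProbabilityMeasure G]
    [IsProbabilityMeasure H] (hG : MemLp id 2 G) (hH : MemLp id 2 H) (hG0 : ∫ x, x ∂G = 0)
    (hH0 : ∫ x, x ∂H = 0) (t : ℝ) :
    ‖charFun G t - charFun H t‖ ≤ ((∫ x, x ^ 2 ∂G) + ∫ x, x ^ 2 ∂H) / 2 * t ^ 2 := by
  have h1 := norm_charFun_sub_one_le hG hG0 t
  have h2 := norm_charFun_sub_one_le hH hH0 t
  have h3 := norm_sub_le (charFun G t - 1) (charFun H t - 1)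
  rw [sub_sub_sub_cancel_right] at h3
  linarith

theorem IsQuicksortLaw.iterate_eq {F : Measure ℝ} (hF : IsQuicksortLaw F) (n : ℕ) :
    quicksortOp^[n] F = F :=
  Function.iterate_fixed hF.fixed n

theorem IsQuicksortLaw.unique {F F' : Measure ℝ} (hF : IsQuicksortLaw F)
    (hF' : IsQuicksortLaw F') : F = F' := by
  have := hF.isProbabilityMeasure
  have := hF'.isProbabilityMeasure
  apply Measure.ext_of_charFun
  funext t
  have h : ∀ n : ℕ, ‖charFun F t - charFun F' t‖ ≤
      (2 / 3) ^ n * (((∫ x, x ^ 2 ∂F) + ∫ x, x ^ 2 ∂F') / 2) * t ^ 2 := by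
    intro n
    have := norm_charFun_iterate_sub_le (norm_charFun_sub_charFun_le hF.memLp hF'.memLp
      hF.mean_zero hF'.mean_zero) n t
    rwa [hF.iterate_eq, hF'.iterate_eq] at this
  have hlim : Filter.Tendsto (fun n : ℕ =>
      (2 / 3 : ℝ) ^ n * (((∫ x, x ^ 2 ∂F) + ∫ x, x ^ 2 ∂F') / 2) * t ^ 2) Filter.atTop
      (nhds 0) := by
    simpa using ((tendsto_pow_atTop_nhds_zero_of_lt_one (r := (2 / 3 : ℝ)) (by norm_num)
      (by norm_num)).mul_const (((∫ x, x ^ 2 ∂F) + ∫ x, x ^ 2 ∂F') / 2)).mul_const (t ^ 2)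
  have := ge_of_tendsto' hlim h
  exact sub_eq_zero.1 (norm_le_zero_iff.1 this)

/-- A probability measure with characteristic function quadratically close to `1` has mean zero
and finite variance. -/
theorem memLp_two_of_norm_charFun_sub_one_le {F : Measure ℝ} [IsProbabilityMeasure F] {C : ℝ}
    (h : ∀ t, ‖charFun F t - 1‖ ≤ C * t ^ 2) : MemLp id 2 F ∧ ∫ x, x ∂F = 0 := by
  have hmem : MemLp id 2 F := by
    rw [memLp_two_iff_integrable_sq (by fun_prop)]
    have hcos : ∀ t : ℝ, ∫ x, (1 - Real.cos (t * x)) ∂F ≤ C * t ^ 2 := by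
      intro t
      have i1 : Integrable (fun x : ℝ => Complex.exp (t * x * Complex.I)) F :=
        integrable_exp_comp t measurable_id
      have e : ∫ x, (1 - Real.cos (t * x)) ∂F = (1 - charFun F t).re := by
        have i2 : Integrable (fun x : ℝ => Real.cos (t * x)) F := by
          refine Integrable.of_bound (C := 1) (by fun_prop)
            (Filter.Eventually.of_forall fun x => ?_)
          exact Real.abs_cos_le_one _
        rw [integral_sub (integrable_const _) i2, Complex.sub_re, charFun_apply_real]
        have := integral_re (𝕜 := ℂ) i1
        simp only [RCLike.re_to_complex] at this
        rw [← this]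
        simp only [← Complex.ofReal_mul, Complex.exp_ofReal_mul_I_re]
        simp
      rw [e]
      refine (Complex.re_le_norm _).trans ?_
      rw [norm_sub_rev]
      exact h t
    set f : ℕ → ℝ → ENNReal := fun k x =>
      ENNReal.ofReal (((k : ℝ) + 1) ^ 2 * (1 - Real.cos ((1 / ((k : ℝ) + 1)) * x))) with hf
    have hfm : ∀ k, Measurable (f k) := fun k => by fun_prop
    have h1 : ∀ k, ∫⁻ x, f k x ∂F ≤ ENNReal.ofReal C := by
      intro k
      rw [hf, ← ofReal_integral_eq_lintegral_ofReal]
      · apply ENNReal.ofReal_le_ofReal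
        rw [integral_const_mul]
        have := hcos (1 / ((k : ℝ) + 1))
        calc _ ≤ ((k : ℝ) + 1) ^ 2 * (C * (1 / ((k : ℝ) + 1)) ^ 2) := by gcongr
          _ = C := by field_simp
      · refine Integrable.const_mul (Integrable.of_bound (C := 2) (by fun_prop)
          (Filter.Eventually.of_forall fun x => ?_)) _
        rw [Real.norm_eq_abs, abs_le]
        constructor <;> linarith [Real.cos_le_one (1 / ((k : ℝ) + 1) * x),
          Real.neg_one_le_cos (1 / ((k : ℝ) + 1) * x)]
      · exact Filter.Eventually.of_forall fun x =>
          mul_nonneg (sq_nonneg _) (sub_nonneg.2 (Real.cos_le_one _))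
    have h2 : ∀ x, ENNReal.ofReal (2 / Real.pi ^ 2 * x ^ 2) ≤
        Filter.liminf (fun k => f k x) Filter.atTop := by
      intro x
      refine Filter.le_liminf_of_le (by isBoundedDefault) ?_
      filter_upwards [Filter.eventually_ge_atTop ⌈|x|⌉₊] with k hk
      have hk' : |x| ≤ (k : ℝ) := (Nat.le_ceil _).trans (by exact_mod_cast hk)
      apply ENNReal.ofReal_le_ofReal
      have hk1 : (0 : ℝ) < (k : ℝ) + 1 := by positivity
      have hb : |1 / ((k : ℝ) + 1) * x| ≤ Real.pi := by
        rw [abs_mul, abs_of_pos (by positivity), one_div, inv_mul_le_iff₀ hk1]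
        have := Real.pi_gt_three
        nlinarith [abs_nonneg x]
      have := Real.cos_le_one_sub_mul_cos_sq hb
      calc _ = ((k : ℝ) + 1) ^ 2 * (2 / Real.pi ^ 2 * (1 / ((k : ℝ) + 1) * x) ^ 2) := by
            field_simp
        _ ≤ _ := by gcongr; linarith
    have h3 : ∫⁻ x, ENNReal.ofReal (2 / Real.pi ^ 2 * x ^ 2) ∂F < ⊤ := by
      calc _ ≤ ∫⁻ x, Filter.liminf (fun k => f k x) Filter.atTop ∂F := lintegral_mono h2
        _ ≤ Filter.liminf (fun k => ∫⁻ x, f k x ∂F) Filter.atTop := lintegral_liminf_le hfm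
        _ ≤ ENNReal.ofReal C := by
          refine Filter.liminf_le_of_frequently_le' (Filter.Frequently.of_forall h1)
        _ < ⊤ := ENNReal.ofReal_lt_top
    have h4 : Integrable (fun x : ℝ => 2 / Real.pi ^ 2 * x ^ 2) F := by
      refine ⟨by fun_prop, ?_⟩
      rw [hasFiniteIntegral_iff_ofReal (Filter.Eventually.of_forall fun x => by positivity)]
      exact h3
    have h5 := h4.const_mul (Real.pi ^ 2 / 2)
    refine h5.congr (Filter.Eventually.of_forall fun x => ?_)
    have := Real.pi_pos
    simp only [id]
    field_simp
  refine ⟨hmem, ?_⟩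
  set m := ∫ x, x ∂F with hm
  set K := (∫ x, x ^ 2 ∂F) / 2 + C
  have hmt : ∀ t : ℝ, 0 < t → |m| ≤ K * t := by
    intro t ht
    have h1 := norm_charFun_sub_taylor_le hmem t
    have h2 := h t
    have h3 : ‖((t * m : ℝ) : ℂ) * Complex.I‖ = t * |m| := by
      rw [norm_mul, Complex.norm_I, mul_one, Complex.norm_real, Real.norm_eq_abs, abs_mul,
        abs_of_pos ht]
    have h4 := norm_sub_le (charFun F t - 1) (charFun F t - 1 - ((t * m : ℝ) : ℂ) * Complex.I)
    rw [sub_sub_cancel, h3] at h4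
    have h5 : t * |m| ≤ t * (K * t) := by
      calc _ ≤ _ := h4
        _ ≤ C * t ^ 2 + (∫ x, x ^ 2 ∂F) / 2 * t ^ 2 := add_le_add h2 h1
        _ = _ := by ring
    exact le_of_mul_le_mul_left h5 ht
  have hlim : Filter.Tendsto (fun t : ℝ => K * t) (nhdsWithin 0 (Set.Ioi 0)) (nhds 0) := by
    have : Filter.Tendsto (fun t : ℝ => K * t) (nhds 0) (nhds (K * 0)) :=
      (continuous_const_mul K).tendsto 0
    rw [mul_zero] at this
    exact this.mono_left nhdsWithin_le_nhds
  have := ge_of_tendsto hlim (Filter.eventually_of_mem self_mem_nhdsWithin hmt)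
  exact abs_eq_zero.1 (le_antisymm this (abs_nonneg m))

/-- Lévy continuity: a pointwise limit of characteristic functions continuous at `0` is a
characteristic function. -/
theorem exists_charFun_eq_of_tendsto {μ : ℕ → Measure ℝ} [∀ n, IsProbabilityMeasure (μ n)]
    {f : ℝ → ℂ} (hf : ContinuousAt f 0)
    (h : ∀ t, Filter.Tendsto (fun n => charFun (μ n) t) Filter.atTop (nhds (f t))) :
    ∃ F : Measure ℝ, IsProbabilityMeasure F ∧ charFun F = f := by
  have ht := isTightMeasureSet_of_tendsto_charFun hf h
  set ν : ℕ → ProbabilityMeasure ℝ := fun n => ⟨μ n, inferInstance⟩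
  have hc : IsCompact (closure (Set.range ν)) := by
    apply isCompact_closure_of_isTightMeasureSet
    convert ht using 1
    ext m
    constructor
    · rintro ⟨_, ⟨n, rfl⟩, rfl⟩
      exact ⟨n, rfl⟩
    · rintro ⟨n, rfl⟩
      exact ⟨ν n, ⟨n, rfl⟩, rfl⟩
  obtain ⟨F, -, hF⟩ := hc.ultrafilter_le_nhds
    ((Filter.hyperfilter ℕ).map ν) (by
      rw [Filter.le_principal_iff]
      exact Filter.mem_of_superset (Filter.mem_map.2 (Filter.Eventually.of_forall
        fun n => Set.mem_range_self n)) subset_closure)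
  have hF' : Filter.Tendsto ν (Filter.hyperfilter ℕ : Filter ℕ) (nhds F) := hF
  refine ⟨F, inferInstance, ?_⟩
  funext t
  rw [ProbabilityMeasure.tendsto_iff_forall_integral_rclike_tendsto ℂ] at hF'
  have h1 := hF' (BoundedContinuousFunction.innerProbChar t)
  simp_rw [← charFun_eq_integral_innerProbChar] at h1
  exact tendsto_nhds_unique h1 ((h t).mono_left Nat.hyperfilter_le_atTop)

theorem exists_isQuicksortLaw : ∃ F : Measure ℝ, IsQuicksortLaw F := by
  set μ : ℕ → Measure ℝ := fun n => quicksortOp^[n] (Measure.dirac 0) with hμ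
  have hp : ∀ n, IsProbabilityMeasure (μ n) := isProbabilityMeasure_iterate_quicksortOp _
  have hd : MemLp id 2 (Measure.dirac (0 : ℝ)) := by
    rw [memLp_two_iff_integrable_sq (by fun_prop)]
    exact integrable_dirac (by simp)
  have hmom := moments_iterate_quicksortOp hd (by simp)
  have hone : ∀ n t, ‖charFun (μ n) t - 1‖ ≤ 3 / 2 * t ^ 2 := by
    intro n t
    refine (norm_charFun_sub_one_le (hmom n).1 (hmom n).2.1 t).trans ?_
    have := (hmom n).2.2
    simp only [integral_dirac] at this
    gcongr
    simpa using this
  have hD : ∀ t, ‖charFun (Measure.dirac (0 : ℝ)) t - charFun (μ 1) t‖ ≤ 3 / 2 * t ^ 2 := by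
    intro t
    have := hone 1 t
    rw [norm_sub_rev]
    simpa using this
  have hstep : ∀ t n, dist (charFun (μ n) t) (charFun (μ (n + 1)) t) ≤
      (3 / 2 * t ^ 2) * (2 / 3) ^ n := by
    intro t n
    have := norm_charFun_iterate_sub_le hD n t
    rw [dist_eq_norm, hμ]
    simp only [Function.iterate_add_apply]
    exact this.trans_eq (by ring)
  have hcau : ∀ t, ∃ z, Filter.Tendsto (fun n => charFun (μ n) t) Filter.atTop (nhds z) :=
    fun t => cauchySeq_tendsto_of_complete
      (cauchySeq_of_le_geometric (2 / 3) _ (by norm_num) (hstep t))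
  choose f hf using hcau
  have hf1 : ∀ t, ‖f t - 1‖ ≤ 3 / 2 * t ^ 2 := fun t =>
    le_of_tendsto' ((hf t).sub_const 1).norm fun n => hone n t
  have hf0 : f 0 = 1 := by
    have := hf1 0
    norm_num at this
    exact sub_eq_zero.1 this
  have hcont : ContinuousAt f 0 := by
    rw [ContinuousAt, hf0, tendsto_iff_norm_sub_tendsto_zero]
    refine squeeze_zero (fun _ => norm_nonneg _) hf1 ?_
    have : Continuous fun t : ℝ => 3 / 2 * t ^ 2 := by fun_prop
    simpa using this.tendsto 0
  obtain ⟨F, hFp, hF⟩ := exists_charFun_eq_of_tendsto hcont hf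
  obtain ⟨hm, h0⟩ := memLp_two_of_norm_charFun_sub_one_le (F := F) (by rwa [hF])
  refine ⟨F, hFp, hm, h0, ?_⟩
  apply Measure.ext_of_charFun
  funext t
  have hfix : Filter.Tendsto (fun n => charFun (quicksortOp (μ n)) t) Filter.atTop
      (nhds (charFun (quicksortOp F) t)) := by
    simp_rw [charFun_quicksortOp]
    refine tendsto_integral_of_dominated_convergence (fun _ => (1 : ℝ))
      (fun n => (integrable_charFun_quicksortOp (μ n) t).aestronglyMeasurable)
      (integrable_const _) (fun n => Filter.Eventually.of_forall fun u => ?_)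
      (Filter.Eventually.of_forall fun u => ?_)
    · rw [norm_mul, norm_mul, norm_exp_mul_mul_I, mul_one]
      exact mul_le_one₀ (norm_charFun_le_one _) (norm_nonneg _) (norm_charFun_le_one _)
    · rw [hF]
      exact ((hf _).mul (hf _)).mul_const _
  refine tendsto_nhds_unique hfix ?_
  rw [hF]
  have := (hf t).comp (Filter.tendsto_add_atTop_nat 1)
  refine this.congr fun n => ?_
  simp only [Function.comp_apply, hμ, Function.iterate_succ_apply']

section Fourier

open FourierTransform SchwartzMap
open scoped ContDiff Manifold

theorem integral_schwartz_eq_integral_fourier_mul_charFun (P : Measure ℝ) [IsProbabilityMeasure P]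
    (h : 𝓢(ℝ, ℂ)) :
    ∫ x, h x ∂P = ∫ ξ, 𝓕 h ξ * charFun P (2 * Real.pi * ξ) := by
  have hinv : ∀ x, h x = ∫ ξ, Complex.exp ((2 * Real.pi * ξ : ℝ) * x * Complex.I) * 𝓕 h ξ := by
    intro x
    have h1 : h x = 𝓕⁻ (𝓕 h) x := by rw [FourierTransform.fourierInv_fourier_eq]
    rw [h1, SchwartzMap.fourierInv_coe, Real.fourierInv_eq']
    refine integral_congr_ae (Filter.Eventually.of_forall fun ξ => ?_)
    simp only [smul_eq_mul]
    congr 2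
    simp
    ring
  have hint : Integrable (fun p : ℝ × ℝ => Complex.exp ((2 * Real.pi * p.2 : ℝ) * p.1 * Complex.I)
      * 𝓕 h p.2) (P.prod volume) := by
    have h1 : Integrable (fun p : ℝ × ℝ => 𝓕 h p.2) (P.prod volume) :=
      (𝓕 h).integrable.comp_snd P
    refine h1.mono (Continuous.aestronglyMeasurable ?_) (Filter.Eventually.of_forall fun p => ?_)
    · have := (𝓕 h).continuous
      fun_prop
    · rw [norm_mul, norm_exp_mul_mul_I, one_mul]
  calc ∫ x, h x ∂P
      = ∫ x : ℝ, (∫ ξ : ℝ, Complex.exp ((2 * Real.pi * ξ : ℝ) * x * Complex.I) * 𝓕 h ξ) ∂P := by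
        exact integral_congr_ae (Filter.Eventually.of_forall hinv)
    _ = ∫ ξ : ℝ, ∫ x : ℝ, Complex.exp ((2 * Real.pi * ξ : ℝ) * x * Complex.I) * 𝓕 h ξ ∂P :=
        integral_integral_swap hint
    _ = _ := by
        refine integral_congr_ae (Filter.Eventually.of_forall fun ξ => ?_)
        simp only
        rw [integral_mul_const, charFun_apply_real, mul_comm]

theorem integrable_fourier_mul_charFun (P : Measure ℝ) [IsProbabilityMeasure P] (h : 𝓢(ℝ, ℂ)) :
    Integrable fun ξ : ℝ => 𝓕 h ξ * charFun P (2 * Real.pi * ξ) := by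
  refine (𝓕 h).integrable.mono ((𝓕 h).continuous.aestronglyMeasurable.mul
    (measurable_charFun.comp (measurable_const_mul _)).aestronglyMeasurable)
    (Filter.Eventually.of_forall fun ξ => ?_)
  rw [norm_mul]
  exact mul_le_of_le_one_right (norm_nonneg _) (norm_charFun_le_one _)

theorem integrable_cauchy_weight {T : ℝ} (hT : 0 < T) (κ : ℝ) :
    Integrable fun ξ : ℝ => 2 * κ / (1 + (2 * Real.pi * ξ / T) ^ 2) := by
  have h := (integrable_inv_one_add_sq.comp_mul_left'
    (show 2 * Real.pi / T ≠ 0 by have := Real.pi_pos; positivity)).const_mul (2 * κ)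
  refine h.congr (Filter.Eventually.of_forall fun ξ => ?_)
  simp only
  rw [div_eq_mul_inv (2 * κ)]
  congr 4
  ring

theorem integral_cauchy_weight {T : ℝ} (hT : 0 < T) (κ : ℝ) :
    ∫ ξ : ℝ, 2 * κ / (1 + (2 * Real.pi * ξ / T) ^ 2) = κ * T := by
  have hpi := Real.pi_pos
  have e : ∀ ξ : ℝ, 2 * κ / (1 + (2 * Real.pi * ξ / T) ^ 2) =
      2 * κ * (1 + (2 * Real.pi / T * ξ) ^ 2)⁻¹ := by
    intro ξ
    rw [div_eq_mul_inv (2 * κ)]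
    congr 4
    ring
  simp_rw [e]
  rw [integral_const_mul, Measure.integral_comp_mul_left (fun x : ℝ => (1 + x ^ 2)⁻¹),
    integral_univ_inv_one_add_sq, abs_of_pos (by positivity), smul_eq_mul]
  field_simp

/-- Plancherel bound for the difference of integrals of a Schwartz function. -/
theorem norm_integral_schwartz_sub_le {P Q : Measure ℝ} [IsProbabilityMeasure P]
    [IsProbabilityMeasure Q] {κ T s : ℝ} (hT : 0 < T) (hs : 0 < s)
    (hφ : ∀ t, ‖charFun P t - charFun Q t‖ ^ 2 ≤ 2 * κ / (1 + (t / T) ^ 2)) (h : 𝓢(ℝ, ℂ)) :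
    ‖∫ x, h x ∂P - ∫ x, h x ∂Q‖ ≤ s / 2 * (∫ x, ‖h x‖ ^ 2) + κ * T / (2 * s) := by
  rw [integral_schwartz_eq_integral_fourier_mul_charFun,
    integral_schwartz_eq_integral_fourier_mul_charFun,
    ← integral_sub (integrable_fourier_mul_charFun P h) (integrable_fourier_mul_charFun Q h),
    ← SchwartzMap.integral_norm_sq_fourier h]
  have i1 : Integrable fun ξ : ℝ => s / 2 * ‖𝓕 h ξ‖ ^ 2 := by
    have := ((𝓕 h).memLp 2 volume).integrable_norm_pow (by norm_num)
    exact Integrable.const_mul (by simpa using this) _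
  have i2 := (integrable_cauchy_weight hT κ).div_const (2 * s)
  refine (norm_integral_le_of_norm_le (i1.add i2) (Filter.Eventually.of_forall fun ξ => ?_)).trans_eq
    ?_
  · rw [← mul_sub, norm_mul]
    have h1 := hφ (2 * Real.pi * ξ)
    set a := ‖𝓕 h ξ‖
    set b := ‖charFun P (2 * Real.pi * ξ) - charFun Q (2 * Real.pi * ξ)‖
    calc a * b ≤ s / 2 * a ^ 2 + b ^ 2 / (2 * s) := by
          have h2 : s / 2 * a ^ 2 + b ^ 2 / (2 * s) - a * b = (s * a - b) ^ 2 / (2 * s) := by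
            field_simp; ring
          have : 0 ≤ (s * a - b) ^ 2 / (2 * s) := by positivity
          linarith
      _ ≤ _ := by
        simp only [Pi.add_apply]
        gcongr
  · simp only [Pi.add_apply]
    rw [integral_add i1 i2, integral_const_mul, integral_div, integral_cauchy_weight hT]

theorem exists_smooth_approx_indicator (P Q : Measure ℝ) [IsProbabilityMeasure P]
    [IsProbabilityMeasure Q] {B : Set ℝ} (hB : MeasurableSet B) (M : ℝ) {η : ℝ} (hη : 0 < η) :
    ∃ h : 𝓢(ℝ, ℝ), (∀ x, h x ∈ Set.Icc (0 : ℝ) 1) ∧ (∀ x ∉ Set.Ioo (-M) M, h x = 0) ∧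
      P.real (B ∩ Set.Ioo (-M) M) ≤ ∫ x, h x ∂P + η ∧ ∫ x, h x ∂Q ≤ Q.real B + η := by
  have hε : ENNReal.ofReal η ≠ 0 := by simpa using hη
  obtain ⟨K, hKB, hKc, hKP⟩ := (hB.inter measurableSet_Ioo).exists_isCompact_sdiff_lt
    (measure_ne_top P (B ∩ Set.Ioo (-M) M)) hε
  obtain ⟨U', hKU', hU'o, -, hU'Q⟩ := hKc.measurableSet.exists_isOpen_sdiff_lt
    (measure_ne_top Q K) hε
  set U := U' ∩ Set.Ioo (-M) M with hU
  have hUo : IsOpen U := hU'o.inter isOpen_Ioo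
  have hKU : K ⊆ U := fun x hx => ⟨hKU' hx, (hKB hx).2⟩
  obtain ⟨f, hf0, hf1, hf⟩ := exists_contMDiffMap_zero_one_of_isClosed (n := ⊤) 𝓘(ℝ, ℝ)
    hUo.isClosed_compl hKc.isClosed (Set.disjoint_left.2 fun x hx hx' => hx (hKU hx'))
  have hout : ∀ x ∉ Set.Ioo (-M) M, f x = 0 := fun x hx => hf0 fun hx' => hx hx'.2
  have hsupp : HasCompactSupport f := HasCompactSupport.intro (isCompact_Icc (a := -M) (b := M))
    fun x hx => hout x fun hx' => hx (Set.Ioo_subset_Icc_self hx')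
  have hsm : ContDiff ℝ ∞ f := f.contMDiff.contDiff
  refine ⟨hsupp.toSchwartzMap hsm, hf, hout, ?_, ?_⟩
  · have hle : P.real K ≤ ∫ x, f x ∂P := by
      rw [← integral_indicator_one hKc.measurableSet]
      refine integral_mono ((integrable_const (1 : ℝ)).indicator hKc.measurableSet)
        ((hsupp.toSchwartzMap hsm).integrable) fun x => ?_
      by_cases hx : x ∈ K
      · rw [Set.indicator_of_mem hx]
        exact (hf1 hx).ge
      · rw [Set.indicator_of_notMem hx]
        exact (hf x).1
    have h2 : P.real ((B ∩ Set.Ioo (-M) M) \ K) ≤ η :=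
      ENNReal.toReal_le_of_le_ofReal hη.le hKP.le
    have h3 : P.real (B ∩ Set.Ioo (-M) M) ≤ P.real K + P.real ((B ∩ Set.Ioo (-M) M) \ K) := by
      rw [← Set.union_sdiff_cancel hKB]
      simpa using measureReal_union_le (μ := P) K ((B ∩ Set.Ioo (-M) M) \ K)
    calc _ ≤ _ := h3
      _ ≤ _ := add_le_add hle h2
  · have hle : ∫ x, f x ∂Q ≤ Q.real U := by
      rw [← integral_indicator_one hUo.measurableSet]
      refine integral_mono ((hsupp.toSchwartzMap hsm).integrable)
        ((integrable_const (1 : ℝ)).indicator hUo.measurableSet) fun x => ?_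
      by_cases hx : x ∈ U
      · rw [Set.indicator_of_mem hx]
        exact (hf x).2
      · rw [Set.indicator_of_notMem hx]
        exact (hf0 hx).le
    have h2 : Q.real (U' \ K) ≤ η := ENNReal.toReal_le_of_le_ofReal hη.le hU'Q.le
    have h3 : Q.real U ≤ Q.real B + Q.real (U' \ K) := by
      refine (measureReal_mono fun x hx => ?_).trans (measureReal_union_le B (U' \ K))
      by_cases hxK : x ∈ K
      · exact Or.inl (hKB hxK).1
      · exact Or.inr ⟨hx.1, hxK⟩
    calc _ ≤ _ := hle
      _ ≤ _ := h3
      _ ≤ _ := by linarith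

theorem measureReal_sub_le_of_charFun {P Q : Measure ℝ} [IsProbabilityMeasure P]
    [IsProbabilityMeasure Q] {κ T s M : ℝ} (hT : 0 < T) (hs : 0 < s) (hM : 0 < M)
    (hφ : ∀ t, ‖charFun P t - charFun Q t‖ ^ 2 ≤ 2 * κ / (1 + (t / T) ^ 2))
    {B : Set ℝ} (hB : MeasurableSet B) :
    P.real B - Q.real B ≤ s * M + κ * T / (2 * s) + P.real (Set.Ioo (-M) M)ᶜ := by
  refine le_of_forall_pos_le_add fun η hη => ?_
  obtain ⟨h, hh, hout, h1, h2⟩ := exists_smooth_approx_indicator P Q hB M (half_pos hη)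
  have hsupp : HasCompactSupport fun x => (h x : ℂ) :=
    HasCompactSupport.intro (isCompact_Icc (a := -M) (b := M))
      fun x hx => by simp [hout x fun hx' => hx (Set.Ioo_subset_Icc_self hx')]
  have hsm : ContDiff ℝ ∞ fun x => (h x : ℂ) := Complex.ofRealCLM.contDiff.comp (h.smooth ⊤)
  have key := norm_integral_schwartz_sub_le hT hs hφ (hsupp.toSchwartzMap hsm)
  simp only [HasCompactSupport.toSchwartzMap_toFun] at key
  rw [integral_complex_ofReal, integral_complex_ofReal, ← Complex.ofReal_sub, Complex.norm_real,
    Real.norm_eq_abs] at key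
  have hL2 : ∫ x, ‖(h x : ℂ)‖ ^ 2 ≤ 2 * M := by
    have e : ∫ x in Set.Ioo (-M) M, ‖(h x : ℂ)‖ ^ 2 = ∫ x, ‖(h x : ℂ)‖ ^ 2 :=
      setIntegral_eq_integral_of_forall_compl_eq_zero fun x hx => by simp [hout x hx]
    rw [← e]
    have := norm_setIntegral_le_of_norm_le_const (μ := volume) (s := Set.Ioo (-M) M) (C := 1)
      (f := fun x => ‖(h x : ℂ)‖ ^ 2) (by simp) (fun x _ => by
        rw [Complex.norm_real, Real.norm_of_nonneg (hh x).1, Real.norm_of_nonneg (sq_nonneg _)]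
        exact pow_le_one₀ (hh x).1 (hh x).2)
    rw [Real.volume_real_Ioo_of_le (by linarith)] at this
    calc _ ≤ _ := Real.le_norm_self _
      _ ≤ _ := this
      _ = _ := by ring
  have h3 := le_abs_self (∫ x, h x ∂P - ∫ x, h x ∂Q)
  have h4 : P.real B ≤ P.real (B ∩ Set.Ioo (-M) M) + P.real (Set.Ioo (-M) M)ᶜ := by
    refine (measureReal_mono fun x hx => ?_).trans (measureReal_union_le _ _)
    by_cases hx' : x ∈ Set.Ioo (-M) M
    · exact Or.inl ⟨hx, hx'⟩
    · exact Or.inr hx'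
  have h5 : s / 2 * ∫ x, ‖(h x : ℂ)‖ ^ 2 ≤ s * M := by
    calc _ ≤ s / 2 * (2 * M) := by gcongr
      _ = _ := by ring
  linarith

end Fourier

theorem measureReal_compl_Ioo_le {P : Measure ℝ} [IsProbabilityMeasure P] (hP : MemLp id 2 P)
    {M : ℝ} (hM : 0 < M) : P.real (Set.Ioo (-M) M)ᶜ ≤ (∫ x, x ^ 2 ∂P) / M ^ 2 := by
  have h := mul_meas_ge_le_integral_of_nonneg (μ := P) (f := fun x : ℝ => x ^ 2)
    (Filter.Eventually.of_forall fun x => sq_nonneg x) (integrable_sq_of_memLp_two hP) (M ^ 2)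
  rw [le_div_iff₀ (by positivity), mul_comm]
  refine le_trans ?_ h
  refine mul_le_mul_of_nonneg_left ?_ (sq_nonneg M)
  refine measureReal_mono (μ := P) (fun x hx => ?_) (measure_ne_top P _)
  simp only [Set.mem_compl_iff, Set.mem_Ioo, ← abs_lt, not_lt] at hx
  simp only [Set.mem_ofPred_eq]
  rw [← sq_abs x]
  gcongr

theorem tvDist_le {P Q : Measure ℝ} {C : ℝ} (h : ∀ B, MeasurableSet B → |P.real B - Q.real B| ≤ C) :
    tvDist P Q ≤ C := by
  have : Nonempty {B : Set ℝ // MeasurableSet B} := ⟨⟨∅, MeasurableSet.empty⟩⟩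
  exact ciSup_le fun B => h B B.2

theorem tvDist_nonneg {P Q : Measure ℝ} : 0 ≤ tvDist P Q := Real.iSup_nonneg fun _ => abs_nonneg _

section Distances

variable {P Q : Measure ℝ} [IsProbabilityMeasure P] [IsProbabilityMeasure Q]

theorem abs_measureReal_sub_le_one (B : Set ℝ) : |P.real B - Q.real B| ≤ 1 := by
  have h1 : P.real B ≤ 1 := measureReal_le_one
  have h2 : Q.real B ≤ 1 := measureReal_le_one
  have h3 : 0 ≤ P.real B := measureReal_nonneg
  have h4 : 0 ≤ Q.real B := measureReal_nonneg
  rw [abs_le]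
  constructor <;> linarith

theorem bddAbove_tvDist :
    BddAbove (Set.range fun B : {B : Set ℝ // MeasurableSet B} => |P.real B - Q.real B|) :=
  ⟨1, by rintro _ ⟨B, rfl⟩; exact abs_measureReal_sub_le_one _⟩

theorem tvDist_le_one : tvDist P Q ≤ 1 := tvDist_le fun B _ => abs_measureReal_sub_le_one B

theorem ksDist_le_tvDist : ksDist P Q ≤ tvDist P Q :=
  ciSup_le fun x => le_ciSup (bddAbove_tvDist (P := P) (Q := Q)) ⟨Set.Iic x, measurableSet_Iic⟩

/-- Two laws whose characteristic functions are close near the origin and decay like `|t|⁻⁵` are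
close in total variation. -/
theorem tvDist_le_of_charFun {d : ℝ} (hd : 0 < d) (hd1 : d ≤ 1)
    (hP : MemLp id 2 P) (hQ : MemLp id 2 Q) (hP2 : ∫ x, x ^ 2 ∂P ≤ 4) (hQ2 : ∫ x, x ^ 2 ∂Q ≤ 4)
    (hclose : ∀ t, ‖charFun P t - charFun Q t‖ ≤ d ^ 20 / 2 * t ^ 2)
    (hPd : ∀ t ≠ 0, ‖charFun P t‖ ≤ 2 ^ 51 / |t| ^ 5)
    (hQd : ∀ t ≠ 0, ‖charFun Q t‖ ≤ 2 ^ 51 / |t| ^ 5) :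
    tvDist P Q ≤ 2 ^ 20 * d ^ 10 := by
  have hT : 0 < 2 ^ 8 / d ^ 3 := by positivity
  have hφ : ∀ t, ‖charFun P t - charFun Q t‖ ^ 2 ≤
      2 * (2 ^ 30 * d ^ 28) / (1 + (t / (2 ^ 8 / d ^ 3)) ^ 2) := by
    intro t
    set T := 2 ^ 8 / d ^ 3 with hTd
    rw [le_div_iff₀ (by positivity)]
    rcases le_total |t| T with h | h
    · have h1 : (t / T) ^ 2 ≤ 1 := by
        rw [← sq_abs, abs_div, abs_of_pos hT]
        exact pow_le_one₀ (by positivity) ((div_le_one hT).2 h)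
      have h2 : ‖charFun P t - charFun Q t‖ ^ 2 ≤ 2 ^ 30 * d ^ 28 := by
        calc _ ≤ (d ^ 20 / 2 * t ^ 2) ^ 2 := by gcongr; exact hclose t
          _ ≤ (d ^ 20 / 2 * T ^ 2) ^ 2 := by
            rw [← sq_abs t]; gcongr
          _ = 2 ^ 30 * d ^ 28 := by rw [hTd]; field_simp
      nlinarith [sq_nonneg (t / T), sq_nonneg ‖charFun P t - charFun Q t‖]
    · have ht0 : 0 < |t| := hT.trans_le h
      have hne : t ≠ 0 := abs_pos.1 ht0
      have h1 : 1 ≤ (|t| / T) ^ 2 := one_le_pow₀ ((one_le_div hT).2 h)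
      have h2 : (t / T) ^ 2 = (|t| / T) ^ 2 := by
        rw [← sq_abs, abs_div, abs_of_pos hT]
      have h3 : ‖charFun P t - charFun Q t‖ ≤ 2 ^ 52 / |t| ^ 5 := by
        calc _ ≤ _ := norm_sub_le _ _
          _ ≤ 2 ^ 51 / |t| ^ 5 + 2 ^ 51 / |t| ^ 5 := add_le_add (hPd t hne) (hQd t hne)
          _ = _ := by ring
      have h4 : ‖charFun P t - charFun Q t‖ ^ 2 * (|t| / T) ^ 2 ≤ 2 ^ 30 * d ^ 28 := by
        calc _ ≤ (2 ^ 52 / |t| ^ 5) ^ 2 * (|t| / T) ^ 2 := by gcongr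
          _ = 2 ^ 104 / (|t| ^ 8 * T ^ 2) := by field_simp
          _ ≤ 2 ^ 104 / (T ^ 8 * T ^ 2) := by gcongr
          _ = 2 ^ 24 * d ^ 28 * d ^ 2 := by rw [hTd]; field_simp
          _ ≤ 2 ^ 30 * d ^ 28 * 1 := by
            gcongr
            · norm_num
            · norm_num
            · exact pow_le_one₀ hd.le hd1
          _ = _ := mul_one _
      rw [h2]
      nlinarith [sq_nonneg ‖charFun P t - charFun Q t‖]
  have hM : 0 < 1 / d ^ 5 := by positivity
  have hs : 0 < 2 ^ 18 * d ^ 15 := by positivity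
  have e : 2 ^ 18 * d ^ 15 * (1 / d ^ 5) + 2 ^ 30 * d ^ 28 * (2 ^ 8 / d ^ 3) / (2 * (2 ^ 18 * d ^ 15))
      + 4 / (1 / d ^ 5) ^ 2 ≤ 2 ^ 20 * d ^ 10 := by
    have : 2 ^ 18 * d ^ 15 * (1 / d ^ 5) +
        2 ^ 30 * d ^ 28 * (2 ^ 8 / d ^ 3) / (2 * (2 ^ 18 * d ^ 15)) + 4 / (1 / d ^ 5) ^ 2 =
        (2 ^ 18 + 2 ^ 19 + 4) * d ^ 10 := by
      field_simp
    rw [this]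
    gcongr
    norm_num
  refine tvDist_le fun B hB => ?_
  rw [abs_sub_le_iff]
  constructor
  · refine (measureReal_sub_le_of_charFun hT hs hM hφ hB).trans (le_trans ?_ e)
    gcongr
    refine (measureReal_compl_Ioo_le hP hM).trans ?_
    gcongr
  · refine (measureReal_sub_le_of_charFun hT hs hM
      (fun t => by rw [norm_sub_rev]; exact hφ t) hB).trans (le_trans ?_ e)
    gcongr
    refine (measureReal_compl_Ioo_le hQ hM).trans ?_
    gcongr

end Distances

theorem IsQuicksortLaw.integral_sq {F : Measure ℝ} (hF : IsQuicksortLaw F) :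
    ∫ x, x ^ 2 ∂F = 3 * tollVar := by
  have := hF.isProbabilityMeasure
  have h := integral_quicksortOp_sq hF.memLp hF.mean_zero
  rw [hF.fixed] at h
  linarith

theorem tvDist_iterate_le {F G : Measure ℝ} (hF : IsQuicksortLaw F) [IsProbabilityMeasure G]
    (hG : MemLp id 2 G) (hG0 : ∫ x, x ∂G = 0) {n : ℕ} (hn : 10 ≤ n) :
    tvDist (quicksortOp^[n] G) F ≤ 2 ^ 20 *
      (Real.sqrt ((∫ x, x ^ 2 ∂G) + ∫ x, x ^ 2 ∂F) * Real.sqrt (2 / 3) ^ n) := by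
  have := hF.isProbabilityMeasure
  have := isProbabilityMeasure_iterate_quicksortOp G n
  have hF3 := hF.integral_sq
  have hG2 : 0 ≤ ∫ x, x ^ 2 ∂G := integral_nonneg fun x => sq_nonneg x
  have htoll := le_tollVar
  have hpos : 0 < (∫ x, x ^ 2 ∂G) + ∫ x, x ^ 2 ∂F := by linarith
  set ρ := Real.sqrt ((∫ x, x ^ 2 ∂G) + ∫ x, x ^ 2 ∂F) * Real.sqrt (2 / 3) ^ n with hρ
  have hρ0 : 0 < ρ := mul_pos (Real.sqrt_pos.2 hpos) (pow_pos (Real.sqrt_pos.2 (by norm_num)) _)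
  have hρ2 : ρ ^ 2 = ((∫ x, x ^ 2 ∂G) + ∫ x, x ^ 2 ∂F) * (2 / 3) ^ n := by
    rw [hρ, mul_pow, Real.sq_sqrt hpos.le, ← pow_mul, mul_comm n 2, pow_mul,
      Real.sq_sqrt (by norm_num)]
  rcases le_total 1 ρ with h1 | h1
  · exact tvDist_le_one.trans (by linarith)
  set d := ρ ^ (1 / 10 : ℝ) with hd
  have hd10 : d ^ 10 = ρ := by
    rw [hd, ← Real.rpow_natCast, ← Real.rpow_mul hρ0.le]
    norm_num
  have hd20 : d ^ 20 = ((∫ x, x ^ 2 ∂G) + ∫ x, x ^ 2 ∂F) * (2 / 3) ^ n := by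
    rw [← hρ2, ← hd10]
    ring
  obtain ⟨hm, -, hm2⟩ := moments_iterate_quicksortOp hG hG0 n
  have h23 : (0 : ℝ) < (2 / 3) ^ n := by positivity
  have hρ1 : ρ ^ 2 ≤ 1 := pow_le_one₀ hρ0.le h1
  have hF0 : 0 ≤ (2 / 3 : ℝ) ^ n * ∫ x, x ^ 2 ∂F := by
    rw [hF3]; exact mul_nonneg h23.le (by linarith)
  rw [← hd10]
  refine tvDist_le_of_charFun (Real.rpow_pos_of_pos hρ0 _)
    (Real.rpow_le_one hρ0.le h1 (by norm_num)) hm hF.memLp (by linarith)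
    (by linarith [tollVar_le_one]) (fun t => ?_)
    (fun t ht => norm_charFun_iterate_le_of_ten_le hn G ht) (fun t ht => ?_)
  · have := norm_charFun_iterate_sub_le
      (norm_charFun_sub_charFun_le hG hF.memLp hG0 hF.mean_zero) n t
    rw [hF.iterate_eq] at this
    refine this.trans_eq ?_
    rw [hd20]
    ring
  · have := norm_charFun_iterate_le_of_ten_le hn F ht
    rwa [hF.iterate_eq] at this

theorem one_le_bound {A : ℝ} (hA : 1 / 10 ≤ A) {n : ℕ} (hn : 1 ≤ n) (hn' : n < 20) :
    1 ≤ 135 * A * n * (2 / 3 : ℝ) ^ ((n : ℝ) / 2 - 3.7 * Real.sqrt n) := by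
  have hn1 : (1 : ℝ) ≤ n := by exact_mod_cast hn
  have hn2 : (n : ℝ) ≤ 20 := by exact_mod_cast hn'.le
  have hs : Real.sqrt n ^ 2 = n := Real.sq_sqrt (by linarith)
  have hs7 : Real.sqrt n ≤ 7 := by
    rw [Real.sqrt_le_left (by norm_num)]; linarith
  have he : (n : ℝ) / 2 - 3.7 * Real.sqrt n ≤ 0 := by
    nlinarith [Real.sqrt_nonneg (n : ℝ)]
  have h1 : 1 ≤ (2 / 3 : ℝ) ^ ((n : ℝ) / 2 - 3.7 * Real.sqrt n) :=
    Real.one_le_rpow_of_pos_of_le_one_of_nonpos (by norm_num) (by norm_num) he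
  have h2 : 1 ≤ 135 * A * n := by nlinarith
  nlinarith

theorem le_bound {A : ℝ} (hA : 0 ≤ A) {n : ℕ} (hn : 20 ≤ n) :
    2 ^ 20 * (A * Real.sqrt (2 / 3) ^ n) ≤
      135 * A * n * (2 / 3 : ℝ) ^ ((n : ℝ) / 2 - 3.7 * Real.sqrt n) := by
  have hn2 : (20 : ℝ) ≤ n := by exact_mod_cast hn
  have hs : 4.4 ≤ Real.sqrt n := by
    apply Real.le_sqrt_of_sq_le
    norm_num
    linarith
  have h1 : (2 / 3 : ℝ) ^ ((n : ℝ) / 2 - 3.7 * Real.sqrt n) =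
      Real.sqrt (2 / 3) ^ n * (2 / 3 : ℝ) ^ (-(3.7 * Real.sqrt n)) := by
    rw [sub_eq_add_neg, Real.rpow_add (by norm_num), Real.sqrt_eq_rpow (2 / 3),
      ← Real.rpow_natCast, ← Real.rpow_mul (by norm_num)]
    congr 2
    ring
  have h2 : (3 / 2 : ℝ) ^ 16 ≤ (2 / 3 : ℝ) ^ (-(3.7 * Real.sqrt n)) := by
    have : (3 / 2 : ℝ) ^ 16 = (2 / 3 : ℝ) ^ (-(16 : ℝ)) := by
      rw [Real.rpow_neg (by norm_num), show (16 : ℝ) = ((16 : ℕ) : ℝ) by norm_num,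
        Real.rpow_natCast]
      norm_num
    rw [this]
    apply Real.rpow_le_rpow_of_exponent_ge (by norm_num) (by norm_num)
    linarith
  rw [h1]
  have hq : 0 ≤ A * Real.sqrt (2 / 3) ^ n := by positivity
  calc _ ≤ (135 * 20 * (3 / 2 : ℝ) ^ 16) * (A * Real.sqrt (2 / 3) ^ n) := by
        gcongr
        norm_num
    _ ≤ (135 * n * (2 / 3 : ℝ) ^ (-(3.7 * Real.sqrt n))) * (A * Real.sqrt (2 / 3) ^ n) := by
        gcongr
    _ = _ := by ring

theorem theorem3p3 :
    (∃! F : Measure ℝ, IsQuicksortLaw F) ∧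
    ∀ F : Measure ℝ, IsQuicksortLaw F →
    ∀ {Ω : Type*} [MeasurableSpace Ω] (μ : Measure Ω) [IsProbabilityMeasure μ] (Z₀ : Ω → ℝ),
      MemLp Z₀ 2 μ → ∫ ω, Z₀ ω ∂μ = 0 →
      (∀ n : ℕ, ksDist (quicksortOp^[n] (μ.map Z₀)) F ≤ tvDist (quicksortOp^[n] (μ.map Z₀)) F) ∧
      (∀ r : ℝ, Real.sqrt (2 / 3) < r →
        (fun n : ℕ => tvDist (quicksortOp^[n] (μ.map Z₀)) F) =O[Filter.atTop]
          (fun n : ℕ => r ^ n)) ∧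
      (∀ n : ℕ, 1 ≤ n →
        tvDist (quicksortOp^[n] (μ.map Z₀)) F ≤
          135 * Real.sqrt (Var[Z₀; μ] + Var[id; F]) * n *
            (2 / 3 : ℝ) ^ ((n : ℝ) / 2 - 3.7 * Real.sqrt n)) := by
  refine ⟨?_, ?_⟩
  · obtain ⟨F, hF⟩ := exists_isQuicksortLaw
    exact ⟨F, hF, fun F' hF' => hF'.unique hF⟩
  intro F hF Ω _ μ _ Z₀ hZ hZ0
  have := hF.isProbabilityMeasure
  have hZm : AEMeasurable Z₀ μ := hZ.aestronglyMeasurable.aemeasurable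
  have : IsProbabilityMeasure (μ.map Z₀) := Measure.isProbabilityMeasure_map hZm
  have hit := isProbabilityMeasure_iterate_quicksortOp (μ.map Z₀)
  have hG : MemLp id 2 (μ.map Z₀) := by
    rw [memLp_map_measure_iff (by fun_prop) hZm]
    exact hZ
  have hG0 : ∫ x, x ∂(μ.map Z₀) = 0 := by
    rw [integral_map hZm (by fun_prop)]
    exact hZ0
  have hvZ : Var[Z₀; μ] = ∫ x, x ^ 2 ∂(μ.map Z₀) := by
    rw [variance_of_integral_eq_zero hZm hZ0, integral_map hZm (by fun_prop)]
  have hvF : Var[id; F] = ∫ x, x ^ 2 ∂F :=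
    variance_of_integral_eq_zero (by fun_prop) hF.mean_zero
  have hA : 1 / 10 ≤ Real.sqrt (Var[Z₀; μ] + Var[id; F]) := by
    apply Real.le_sqrt_of_sq_le
    have := variance_nonneg Z₀ μ
    rw [hvF, hF.integral_sq]
    linarith [le_tollVar]
  have hmain : ∀ n : ℕ, 10 ≤ n → tvDist (quicksortOp^[n] (μ.map Z₀)) F ≤
      2 ^ 20 * (Real.sqrt (Var[Z₀; μ] + Var[id; F]) * Real.sqrt (2 / 3) ^ n) := by
    intro n hn
    rw [hvZ, hvF]
    exact tvDist_iterate_le hF hG hG0 hn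
  refine ⟨fun n => ksDist_le_tvDist, fun r hr => ?_, fun n hn => ?_⟩
  · refine Asymptotics.IsBigO.of_bound (2 ^ 20 * Real.sqrt (Var[Z₀; μ] + Var[id; F])) ?_
    filter_upwards [Filter.eventually_ge_atTop 10] with n hn
    rw [Real.norm_of_nonneg tvDist_nonneg, norm_pow, Real.norm_eq_abs]
    refine (hmain n hn).trans ?_
    rw [← mul_assoc]
    gcongr
    exact hr.le.trans (le_abs_self r)
  · rcases lt_or_ge n 20 with h | h
    · exact tvDist_le_one.trans (one_le_bound hA hn h)
    · exact (hmain n (by omega)).trans (le_bound (by positivity) h)
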